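/- **Setting.** Let $n$ be coprime with $5$. Five identical, oblivious robots live on an anonymous, unoriented ring of $n$ nodes. Each robot repeats a cycle of three phases: *look* (take a snapshot of the number of robots on every node), *compute* (choose, from this snapshot only, a neighbouring node or its own node), *move* (jump instantaneously to the chosen node). In the asynchronous (CORDA) model a scheduler activates an arbitrary set of robots at each instant; each activated robot performs the next phase of its cycle, so robots may move according to outdated snapshots. The scheduler is fair: each robot is activated infinitely often. Initially all robots are about to look. A *tower* is a node with at least two robots. **Definitions.** The *inter-distance* $d$ of a configuration is the minimum distance between two distinct robots. A *$d$.block* is a maximal elementary path carrying at least two robots, one every $d$ edges; its size is its number of robots. A robot is *isolated* if it is in no $d$.block. A configuration is *symmetric* if some reflection of the ring preserves it. A *single $1$.block* is a configuration whose five robots occupy five consecutive nodes. **Block Module.** A robot whose snapshot contains neither a tower nor a single $1$.block decides as follows ($d$ is the inter-distance of the snapshot); it stays idle where no rule applies to it, and the adversary decides where a rule allows two directions. 1. There is an isolated robot and exactly one $d$.block: the isolated robots closest to the $d$.block move one step toward it along a shortest path. 2. There is an isolated robot and there are exactly two $d$.blocks: the isolated robot moves one step, toward either one of the two blocks if the configuration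 is symmetric, and toward the closest one otherwise. 3. There is no isolated robot, exactly one $d$.block, and $d>1$: the two robots at the border of the block (those next to a hole of at least $d$ empty nodes) move one step inwards. 4. There is no isolated robot and there are exactly two $d$.blocks: the robots of the smaller block that are closest to the bigger block move one step toward it along a shortest path. For snapshots that contain a tower or a single $1$.block, the protocol may be arbitrary. **Lemma.** There is an absolute constant $C$ such that, for every $n$ coprime with $5$ and every fair asynchronous execution on the ring of $n$ nodes that starts from a configuration without tower, there is an instant $t$ at which the configuration is a single $1$.block, no configuration at an instant $s\le t$ contains a tower, and at most $C\,n$ robot moves are performed before $t$. -/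

import Mathlib

open scoped Classical in
/-- Everything needed to speak of five robots on the ring of `n` nodes; the nodes are `ZMod n`,
and `u` is linked to `u + 1` and to `u - 1`. A snapshot (what a robot sees when it looks) is the
multiplicity function `c : ZMod n → ℕ`, giving the number of robots on every node. All notions
below are invariant under the rotations and the reflections of the ring, and they do not refer to
robot names: robots are anonymous and the ring is unoriented. -/
noncomputable def RingRobots.multiplicity {n : ℕ} (pos : Fin 5 → ZMod n) : ZMod n → ℕ :=
  fun u => (Finset.univ.filter (fun i => pos i = u)).card

namespace RingRobots

variable {n : ℕ}

/-- Two nodes are neighbours. -/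
def Adj (u v : ZMod n) : Prop := v = u + 1 ∨ v = u - 1

/-- Number of edges of a shortest path from `u` to `v` on the ring. -/
def ringDist (u v : ZMod n) : ℕ := min (u - v).val (v - u).val

/-- At least one robot stands on `u`. -/
def Occupied (c : ZMod n → ℕ) (u : ZMod n) : Prop := 0 < c u

/-- Some node carries at least two robots. -/
def HasTower (c : ZMod n → ℕ) : Prop := ∃ u, 2 ≤ c u

/-- The inter-distance: the minimum of the distances between two distinct robots (two robots on
the same node are at distance `0`). -/
noncomputable def interDist (c : ZMod n → ℕ) : ℕ :=
  sInf {k | ∃ u v, Occupied c u ∧ Occupied c v ∧ (u ≠ v ∨ 2 ≤ c u) ∧ k = ringDist u v}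

/-- The nodes `u, u + d, …, u + (m - 1) d`. -/
def stations (d : ℕ) (u : ZMod n) (m : ℕ) : Finset (ZMod n) :=
  (Finset.range m).image (fun i => u + ((i * d : ℕ) : ZMod n))

/-- `B` is the set of occupied nodes of an elementary path `u, u + 1, …, u + (m - 1) d` that
carries at least two robots, namely one every `d` edges. -/
def IsSpacedPath (c : ZMod n → ℕ) (d : ℕ) (B : Finset (ZMod n)) : Prop :=
  ∃ (u : ZMod n) (m : ℕ), 2 ≤ m ∧ (m - 1) * d < n ∧
    (∀ k ≤ (m - 1) * d, Occupied c (u + (k : ZMod n)) ↔ d ∣ k) ∧ B = stations d u m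

/-- `B` is (the set of occupied nodes of) a `d`.block: a maximal such path. -/
def IsBlock (c : ZMod n → ℕ) (d : ℕ) (B : Finset (ZMod n)) : Prop :=
  Maximal (IsSpacedPath c d) B

/-- The five robots form a single `1`.block, i.e. occupy five consecutive nodes. -/
def IsSingleOneBlock (c : ZMod n → ℕ) : Prop := ∃ B, IsBlock c 1 B ∧ B.card = 5

/-- `u` carries an isolated robot: one that belongs to no `d`.block, `d` the inter-distance. -/
def Isolated (c : ZMod n → ℕ) (u : ZMod n) : Prop :=
  Occupied c u ∧ ∀ B, IsBlock c (interDist c) B → u ∉ B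

/-- Distance from a node to a block. -/
noncomputable def distTo (u : ZMod n) (B : Finset (ZMod n)) : ℕ :=
  sInf {k | ∃ v ∈ B, k = ringDist u v}

/-- `v` is the node next to `u` on a shortest path from `u` to the block `B`: the target of a
robot that moves from `u` toward `B` taking the shortest hole. -/
def Toward (u : ZMod n) (B : Finset (ZMod n)) (v : ZMod n) : Prop :=
  Adj u v ∧ distTo v B + 1 = distTo u B

/-- The configuration has an axis of symmetry. -/
def Symmetric (c : ZMod n → ℕ) : Prop := ∃ s, ∀ x, c (s - x) = c x

/-- The Block Module: in a snapshot `c` it tells a robot on node `u` to move to the neighbouring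
node `v`. If there are several such `v`, then the adversary decides. -/
inductive BlockModule (c : ZMod n → ℕ) (u v : ZMod n) : Prop
  /-- There are isolated robots and a single block: the isolated robots closest to the block move
  toward it. -/
  | isolatedSingle (B : Finset (ZMod n))
      (single : ∀ B', IsBlock c (interDist c) B' ↔ B' = B)
      (me : Isolated c u)
      (closest : ∀ w, Isolated c w → distTo u B ≤ distTo w B)
      (move : Toward u B v)
  /-- There is an isolated robot, there are two blocks, and the configuration is symmetric: the
  isolated robot moves toward any of the two blocks. -/
  | isolatedTwoSymmetric (B₁ B₂ : Finset (ZMod n)) (ne : B₁ ≠ B₂)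
      (two : ∀ B', IsBlock c (interDist c) B' ↔ B' = B₁ ∨ B' = B₂)
      (symm : Symmetric c)
      (me : Isolated c u)
      (move : Toward u B₁ v)
  /-- There is an isolated robot, there are two blocks, and the configuration is not symmetric:
  the isolated robot moves toward the closest block. -/
  | isolatedTwoAsymmetric (B₁ B₂ : Finset (ZMod n)) (ne : B₁ ≠ B₂)
      (two : ∀ B', IsBlock c (interDist c) B' ↔ B' = B₁ ∨ B' = B₂)
      (asymm : ¬ Symmetric c)
      (me : Isolated c u)
      (closest : distTo u B₁ ≤ distTo u B₂)
      (move : Toward u B₁ v)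
  /-- There is no isolated robot and a single `d`.block with `d > 1`: a robot at the border (next
  to a hole of size at least `d`, which lies on the side `e = ± 1`) moves inwards. -/
  | border (B : Finset (ZMod n))
      (noIsolated : ∀ w, ¬ Isolated c w)
      (single : ∀ B', IsBlock c (interDist c) B' ↔ B' = B)
      (large : 1 < interDist c)
      (me : u ∈ B) (e : ZMod n) (side : e = 1 ∨ e = -1)
      (hole : ∀ j : ℕ, 1 ≤ j → j ≤ interDist c → ¬ Occupied c (u + e * (j : ZMod n)))
      (move : v = u - e)
  /-- There is no isolated robot and there are two blocks: the robots of the smaller block `S` that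
  are closest to the bigger block `L` move toward it. -/
  | twoBlocks (S L : Finset (ZMod n))
      (noIsolated : ∀ w, ¬ Isolated c w)
      (two : ∀ B', IsBlock c (interDist c) B' ↔ B' = S ∨ B' = L)
      (smaller : S.card < L.card)
      (me : u ∈ S)
      (closest : ∀ w ∈ S, distTo u L ≤ distTo w L)
      (move : Toward u L v)

/-- `v` is a possible outcome of the compute phase of a robot on `u` whose snapshot is `c`
(`v = u` means that it stays idle). The Block Module runs as long as there is neither a tower nor
a single `1`.block. In the other snapshots a later module of the exploration protocol takes over;
here it may be any protocol whatsoever. -/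
def Decides (c : ZMod n → ℕ) (u v : ZMod n) : Prop :=
  (v = u ∨ Adj u v) ∧
  (¬ HasTower c ∧ ¬ IsSingleOneBlock c →
    BlockModule c u v ∨ (v = u ∧ ∀ w, ¬ BlockModule c u w))

/-- Where a robot is in its look-compute-move cycle: about to look; about to compute from the
snapshot it took; about to move to the node it chose. -/
inductive Phase (n : ℕ) : Type
  | look : Phase n
  | compute (snapshot : ZMod n → ℕ) : Phase n
  | move (target : ZMod n) : Phase n

/-- A global state: the position and the phase of each robot. -/
structure State (n : ℕ) where
  pos : Fin 5 → ZMod n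
  phase : Fin 5 → Phase n

/-- The multiplicity function of the configuration of a global state. -/
noncomputable def State.config (s : State n) : ZMod n → ℕ := multiplicity s.pos

/-- Robot `i`, activated in state `s`, performs the current phase of its cycle, which puts it on
node `p` in phase `q`. Snapshots and targets may be outdated when they are used. -/
inductive RobotStep (s : State n) (i : Fin 5) (p : ZMod n) (q : Phase n) : Prop
  | look (h : s.phase i = Phase.look) (hp : p = s.pos i) (hq : q = Phase.compute s.config)
  | compute (c : ZMod n → ℕ) (v : ZMod n) (h : s.phase i = Phase.compute c)
      (hv : Decides c (s.pos i) v) (hp : p = s.pos i) (hq : q = Phase.move v)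
  | move (v : ZMod n) (h : s.phase i = Phase.move v) (hp : p = v) (hq : q = Phase.look)

/-- A fair asynchronous (CORDA) execution: at each instant `t` the scheduler activates a set
`active t` of robots, each of which performs one phase of its cycle, while the others do nothing;
every robot is activated infinitely often; at the start all robots are about to look. -/
structure Execution (n : ℕ) where
  state : ℕ → State n
  active : ℕ → Set (Fin 5)
  init : ∀ i, (state 0).phase i = Phase.look
  step_active : ∀ t, ∀ i ∈ active t,
    RobotStep (state t) i ((state (t + 1)).pos i) ((state (t + 1)).phase i)
  step_inactive : ∀ t, ∀ i ∉ active t,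
    (state (t + 1)).pos i = (state t).pos i ∧ (state (t + 1)).phase i = (state t).phase i
  fair : ∀ i t, ∃ t' ≥ t, i ∈ active t'

/-- The total number of robot moves (from a node to a neighbouring node) before instant `t`. -/
def Execution.moves (E : Execution n) (t : ℕ) : ℕ :=
  ∑ s ∈ Finset.range t,
    (Finset.univ.filter (fun i => (E.state (s + 1)).pos i ≠ (E.state s).pos i)).card

end RingRobots

/-! While there is no tower the robots keep their cyclic order, so a configuration amounts to five
positive gaps with sum `n`. Asynchrony matters only through decisions taken on old snapshots. The
invariant (`Admissible`) is that every pending decision satisfies `MayAdvance` for the current gaps,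
read in the direction of the move.

`MayAdvance` is weaker than what the Block Module demands of a fresh snapshot. It is weak enough to
survive the admissible moves of the other robots (the `fwd` and `bwd` lemmas), yet strong enough to
forbid collisions (`MayAdvance.one_lt`) and to make each move lower a potential by one
(`MayAdvance.rank`). Simultaneous moves can therefore be replayed one at a time
(`MayMove.simultaneous`).

The potential `Rank` follows the life of a block with inter-distance `d`: it absorbs the other
robots until all five form a `d`.block, of value `9 * d`; the first inward border move then creates
the inter-distance `d - 1` with value at most `9 * d - 1`. Only five equal gaps have no rank, and
coprimality with `5` excludes them. The initial value is at most `9 * n`, whence `C = 9`.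

`IsFrame.sound` links this arithmetic to the ring: fresh decisions are admissible, and some robot
wants to move unless there is a single `1`.block. Fairness turns such a wish into a move
(`Execution.exists_move`), and the number of moves is bounded, so a single `1`.block must appear. -/

namespace RingRobots

/-! ### Arithmetic of five gaps: admissible decisions and the potential. -/

/-- `MayAdvance x₁ x₂ x₃ x₄ x₅`: a robot that sees the gaps `x₁, …, x₅`, listed in one direction,
may have a (possibly outdated) decision to move in this direction. -/
def MayAdvance (x₁ x₂ x₃ x₄ x₅ : ℕ) : Prop :=
  -- The mover crosses `x₁` and leaves `x₅` behind. A fresh snapshot gives `x₁ ≤ x₃`, but `x₃`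
  -- shrinks when the robot at the other end of the block moves in, whereas `x₃ + x₄` does not
  -- change. The next alternative uses `x₄ + x₅` for the same reason.
  (x₂ < x₁ ∧ x₂ < x₃ ∧ x₂ < x₄ ∧ x₂ < x₅ ∧ x₁ + x₂ ≤ x₃ + x₄) ∨
  (x₃ = x₂ ∧ x₂ < x₁ ∧ x₂ < x₄ ∧ x₂ ≤ x₅ ∧ x₁ + x₂ ≤ x₄ + x₅) ∨
  (x₃ = x₂ ∧ x₄ = x₂ ∧ x₂ < x₁ ∧ x₁ ≤ x₅) ∨
  (x₄ = x₂ ∧ x₂ < x₁ ∧ x₂ < x₃ ∧ x₂ < x₅ ∧ x₁ ≤ x₅) ∨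
  (x₂ = x₁ ∧ x₃ = x₁ ∧ x₄ = x₁ ∧ 1 < x₁ ∧ x₁ < x₅) ∨
  -- The last three alternatives are outdated border decisions: the opposite border robot has
  -- already moved in, and the robots between may have started to follow it. The hole of at least
  -- `x₄ + 3` makes the last one end in `x₁ ≤ x₅`, as a block of four requires.
  (x₁ = x₄ + 1 ∧ x₂ = x₄ + 1 ∧ x₃ = x₄ + 1 ∧ x₄ + 3 ≤ x₅) ∨
  (x₁ = x₄ + 1 ∧ x₂ = x₄ + 2 ∧ x₃ = x₄ ∧ x₄ + 3 ≤ x₅) ∨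
  (x₁ = x₄ + 2 ∧ x₂ = x₄ + 1 ∧ x₃ = x₄ ∧ x₄ + 3 ≤ x₅)

/-- The gaps `x₁, …, x₅` are in normal position, the minimal one being `x₁`, and at most `k` moves
remain to be done. -/
def RankFrom (x₁ x₂ x₃ x₄ x₅ k : ℕ) : Prop :=
  (x₁ < x₂ ∧ x₁ < x₃ ∧ x₁ < x₄ ∧ x₁ < x₅ ∧
    -- A gap next to the block is capped by the distance at which the next robot beyond the opposite
    -- end stands once the nearer one has joined there. The weights 2 and 1 make a move from `x₂`
    -- into `x₃`, or from `x₅` into `x₄`, cost exactly one.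
    3 * x₁ + 2 * min x₂ (x₄ + x₅ - x₁) + 2 * min x₅ (x₂ + x₃ - x₁) + x₃ + x₄ ≤ k) ∨
  (x₂ = x₁ ∧ x₁ < x₃ ∧ x₁ ≤ x₄ ∧ x₁ < x₅ ∧
    -- A robot that joins stands at distance `x₁`, so its term merges into the multiple of `x₁`: 7,
    -- then 8, then 9.
    7 * x₁ + min x₃ (x₄ + x₅ - x₁) + min x₅ (x₃ + x₄ - x₁) ≤ k) ∨
  (x₂ = x₁ ∧ x₃ = x₁ ∧ x₁ < x₄ ∧ x₁ < x₅ ∧ 8 * x₁ + min x₄ x₅ ≤ k) ∨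
  (x₂ = x₁ ∧ x₃ = x₁ ∧ x₄ = x₁ ∧ x₁ < x₅ ∧ 9 * x₁ ≤ k) ∨
  (x₃ = x₁ ∧ x₁ < x₂ ∧ x₁ < x₄ ∧ x₁ < x₅ ∧
    6 * x₁ + min x₄ x₅ + 2 * min x₂ (x₄ + x₅ - x₁) ≤ k)

/-- Up to a rotation, the gaps are in normal position, and at most `k` moves remain. -/
def Rank (x₁ x₂ x₃ x₄ x₅ k : ℕ) : Prop :=
  RankFrom x₁ x₂ x₃ x₄ x₅ k ∨ RankFrom x₂ x₃ x₄ x₅ x₁ k ∨ RankFrom x₃ x₄ x₅ x₁ x₂ k ∨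
    RankFrom x₄ x₅ x₁ x₂ x₃ k ∨ RankFrom x₅ x₁ x₂ x₃ x₄ k

theorem Rank.rotate {x₁ x₂ x₃ x₄ x₅ k : ℕ} (h : Rank x₁ x₂ x₃ x₄ x₅ k) :
    Rank x₂ x₃ x₄ x₅ x₁ k := by
  unfold Rank at *; tauto

theorem Rank.reverse {x₁ x₂ x₃ x₄ x₅ k : ℕ} (h : Rank x₁ x₂ x₃ x₄ x₅ k) :
    Rank x₅ x₄ x₃ x₂ x₁ k := by
  have key : ∀ {x₁ x₂ x₃ x₄ x₅ : ℕ}, RankFrom x₁ x₂ x₃ x₄ x₅ k → Rank x₅ x₄ x₃ x₂ x₁ k := by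
    intro x₁ x₂ x₃ x₄ x₅ h
    unfold Rank
    rcases h with h | h | h | h | h
    · right; right; right; right; left; omega
    · right; right; right; left; right; left; omega
    · right; right; left; right; right; left; omega
    · right; left; right; right; right; left; omega
    · right; right; left; right; right; right; right; omega
  rcases h with h | h | h | h | h
  · exact key h
  · exact (key h).rotate
  · exact (key h).rotate.rotate
  · exact (key h).rotate.rotate.rotate
  · exact (key h).rotate.rotate.rotate.rotate

/-- This is what prevents towers: the robot ahead is never adjacent to the mover. -/
theorem MayAdvance.one_lt {x₁ x₂ x₃ x₄ x₅ : ℕ} (h : MayAdvance x₁ x₂ x₃ x₄ x₅) (h₂ : 0 < x₂)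
    (h₄ : 0 < x₄) : 1 < x₁ := by
  unfold MayAdvance at h; omega

-- Under `MayAdvance` the minimum containing the crossed gap is attained at that gap, and the sums
-- in the other caps contain both changed gaps or neither, so a move within one pattern costs one.
-- An inward border move from gaps `d` gives `3 * (d - 1) + 2 * d + 2 * (d + 1) + d + d = 9 * d -
-- 1`.
set_option maxHeartbeats 2000000 in
theorem MayAdvance.rank {x₁ x₂ x₃ x₄ x₅ k : ℕ} (h : MayAdvance x₁ x₂ x₃ x₄ x₅)
    (hk : Rank x₁ x₂ x₃ x₄ x₅ k) (h₂ : 0 < x₂) (h₄ : 0 < x₄) :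
    0 < k ∧ Rank (x₁ - 1) x₂ x₃ x₄ (x₅ + 1) (k - 1) := by
  have h₁ := h.one_lt h₂ h₄
  unfold Rank RankFrom at *
  rcases h with h | h | h | h | h | h | h | h
  all_goals
    rcases hk with (hk | hk | hk | hk | hk) | (hk | hk | hk | hk | hk) | (hk | hk | hk | hk | hk) |
      (hk | hk | hk | hk | hk) | (hk | hk | hk | hk | hk)
    all_goals try (exfalso; omega)
    all_goals
      refine ⟨by omega, ?_⟩
      -- Equality is the critical value at which the moved gap reaches `x₂` and the normal form may
      -- change.
      obtain e | e : x₁ = x₂ + 1 ∨ x₁ ≠ x₂ + 1 := em _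
      all_goals
        first
        | left
          first
          | (left; omega) | (right; left; omega) | (right; right; left; omega)
          | (right; right; right; left; omega) | (right; right; right; right; omega)
        | right; left
          first
          | (left; omega) | (right; left; omega) | (right; right; left; omega)
          | (right; right; right; left; omega) | (right; right; right; right; omega)
        | right; right; left
          first
          | (left; omega) | (right; left; omega) | (right; right; left; omega)
          | (right; right; right; left; omega) | (right; right; right; right; omega)
        | right; right; right; left
          first
          | (left; omega) | (right; left; omega) | (right; right; left; omega)
          | (right; right; right; left; omega) | (right; right; right; right; omega)

/-- In `fwdᵢ` and `bwdᵢ` the waiting robot has index `0`, and robot `i` moves in the same or in the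
opposite direction. Two decisions in the same direction coexist only when one is an outdated border
decision. Here the waiting robot owns it, and it passes to its next form or becomes the approach to
a block of four. -/
theorem MayAdvance.fwd₁ {x₁ x₂ x₃ x₄ x₅ : ℕ} (h : MayAdvance x₁ x₂ x₃ x₄ x₅)
    (h' : MayAdvance x₂ x₃ x₄ x₅ x₁) :
    MayAdvance (x₁ + 1) (x₂ - 1) x₃ x₄ x₅ := by
  unfold MayAdvance at *
  rcases h with h | h | h | h | h | h | h | h <;>
    rcases h' with h' | h' | h' | h' | h' | h' | h' | h' <;> try (exfalso; omega)
  all_goals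
    first
    | (right; right; left; omega)
    | (right; right; right; right; right; right; right; omega)

theorem MayAdvance.fwd₂ {x₁ x₂ x₃ x₄ x₅ : ℕ} (h : MayAdvance x₁ x₂ x₃ x₄ x₅)
    (h' : MayAdvance x₃ x₄ x₅ x₁ x₂) :
    MayAdvance x₁ (x₂ + 1) (x₃ - 1) x₄ x₅ := by
  unfold MayAdvance at *
  rcases h with h | h | h | h | h | h | h | h <;>
    rcases h' with h' | h' | h' | h' | h' | h' | h' | h' <;> try (exfalso; omega)
  all_goals (right; right; right; right; right; right; left; omega)

/-- Robot `3` executes the outdated border decision here. The waiting robot was the middle one, and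
it becomes the isolated robot between two blocks of two. -/
theorem MayAdvance.fwd₃ {x₁ x₂ x₃ x₄ x₅ : ℕ} (h : MayAdvance x₁ x₂ x₃ x₄ x₅)
    (h' : MayAdvance x₄ x₅ x₁ x₂ x₃) :
    MayAdvance x₁ x₂ (x₃ + 1) (x₄ - 1) x₅ := by
  unfold MayAdvance at *
  rcases h with h | h | h | h | h | h | h | h <;>
    rcases h' with h' | h' | h' | h' | h' | h' | h' | h' <;> try (exfalso; omega)
  all_goals (right; right; right; left; omega)

theorem MayAdvance.fwd₄ {x₁ x₂ x₃ x₄ x₅ : ℕ} (h : MayAdvance x₁ x₂ x₃ x₄ x₅)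
    (h' : MayAdvance x₅ x₁ x₂ x₃ x₄) :
    MayAdvance x₁ x₂ x₃ (x₄ + 1) (x₅ - 1) := by
  unfold MayAdvance at *
  rcases h with h | h | h | h | h | h | h | h <;>
    rcases h' with h' | h' | h' | h' | h' | h' | h' | h' <;> try (exfalso; omega)
  all_goals (right; left; omega)

/-- Two robots facing each other across one gap, or (in `bwd₂`) across a single intermediate robot,
never both have pending decisions: the hypotheses are contradictory. -/
theorem MayAdvance.bwd₁ {x₁ x₂ x₃ x₄ x₅ : ℕ} (h : MayAdvance x₁ x₂ x₃ x₄ x₅)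
    (h' : MayAdvance x₁ x₅ x₄ x₃ x₂) :
    MayAdvance (x₁ - 1) (x₂ + 1) x₃ x₄ x₅ := by
  unfold MayAdvance at *
  rcases h with h | h | h | h | h | h | h | h <;>
    rcases h' with h' | h' | h' | h' | h' | h' | h' | h' <;> exfalso <;> omega

theorem MayAdvance.bwd₂ {x₁ x₂ x₃ x₄ x₅ : ℕ} (h : MayAdvance x₁ x₂ x₃ x₄ x₅)
    (h' : MayAdvance x₂ x₁ x₅ x₄ x₃) :
    MayAdvance x₁ (x₂ - 1) (x₃ + 1) x₄ x₅ := by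
  unfold MayAdvance at *
  rcases h with h | h | h | h | h | h | h | h <;>
    rcases h' with h' | h' | h' | h' | h' | h' | h' | h' <;> exfalso <;> omega

/-- Both robots approach a block of two, from its two ends. If robot `3` arrives, the waiting robot
faces a block of three. -/
theorem MayAdvance.bwd₃ {x₁ x₂ x₃ x₄ x₅ : ℕ} (h : MayAdvance x₁ x₂ x₃ x₄ x₅)
    (h' : MayAdvance x₃ x₂ x₁ x₅ x₄) :
    MayAdvance x₁ x₂ (x₃ - 1) (x₄ + 1) x₅ := by
  unfold MayAdvance at *
  rcases h with h | h | h | h | h | h | h | h <;>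
    rcases h' with h' | h' | h' | h' | h' | h' | h' | h' <;> try (exfalso; omega)
  all_goals
    rcases Decidable.em (x₃ = x₂ + 1) with e | e <;>
      first | (left; omega) | (right; left; omega)

/-- Either both robots approach a block of three, or they are the two borders of a block of five; in
the latter case the waiting decision becomes outdated. -/
theorem MayAdvance.bwd₄ {x₁ x₂ x₃ x₄ x₅ : ℕ} (h : MayAdvance x₁ x₂ x₃ x₄ x₅)
    (h' : MayAdvance x₄ x₃ x₂ x₁ x₅) :
    MayAdvance x₁ x₂ x₃ (x₄ - 1) (x₅ + 1) := by
  unfold MayAdvance at *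
  rcases h with h | h | h | h | h | h | h | h <;>
    rcases h' with h' | h' | h' | h' | h' | h' | h' | h' <;> try (exfalso; omega)
  all_goals
    rcases Decidable.em (x₄ = x₂ + 1) with e | e <;>
      first
      | (right; left; omega)
      | (right; right; left; omega)
      | (right; right; right; right; right; left; omega)

/-- A minimal gap can be rotated to the front, and the positions of the other minimal gaps then
select a normal form. -/
theorem exists_rank {x₁ x₂ x₃ x₄ x₅ : ℕ} (h : ¬ (x₂ = x₁ ∧ x₃ = x₁ ∧ x₄ = x₁ ∧ x₅ = x₁)) :
    Rank x₁ x₂ x₃ x₄ x₅ (9 * (x₁ + x₂ + x₃ + x₄ + x₅)) := by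
  have key : ∀ {k x₁ x₂ x₃ x₄ x₅ : ℕ}, ¬ (x₂ = x₁ ∧ x₃ = x₁ ∧ x₄ = x₁ ∧ x₅ = x₁) →
      k = 9 * (x₁ + x₂ + x₃ + x₄ + x₅) → x₁ ≤ x₂ → x₁ ≤ x₃ → x₁ ≤ x₄ → x₁ ≤ x₅ →
      Rank x₁ x₂ x₃ x₄ x₅ k := by
    intro k x₁ x₂ x₃ x₄ x₅ h hk h₂ h₃ h₄ h₅
    unfold Rank RankFrom
    rcases h₂.eq_or_lt with h₂ | h₂ <;> rcases h₃.eq_or_lt with h₃ | h₃ <;>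
      rcases h₄.eq_or_lt with h₄ | h₄ <;> rcases h₅.eq_or_lt with h₅ | h₅ <;>
      try (exfalso; omega)
    all_goals
      first
      | left
        first
        | (left; omega) | (right; left; omega) | (right; right; left; omega)
        | (right; right; right; left; omega) | (right; right; right; right; omega)
      | right; left
        first
        | (left; omega) | (right; left; omega) | (right; right; left; omega)
        | (right; right; right; left; omega) | (right; right; right; right; omega)
      | right; right; left
        first
        | (left; omega) | (right; left; omega) | (right; right; left; omega)
        | (right; right; right; left; omega) | (right; right; right; right; omega)
      | right; right; right; left
        first
        | (left; omega) | (right; left; omega) | (right; right; left; omega)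
        | (right; right; right; left; omega) | (right; right; right; right; omega)
      | right; right; right; right
        first
        | (left; omega) | (right; left; omega) | (right; right; left; omega)
        | (right; right; right; left; omega)
  generalize hk : 9 * (x₁ + x₂ + x₃ + x₄ + x₅) = k
  have : (x₁ ≤ x₂ ∧ x₁ ≤ x₃ ∧ x₁ ≤ x₄ ∧ x₁ ≤ x₅) ∨ (x₂ ≤ x₃ ∧ x₂ ≤ x₄ ∧ x₂ ≤ x₅ ∧ x₂ ≤ x₁) ∨
      (x₃ ≤ x₄ ∧ x₃ ≤ x₅ ∧ x₃ ≤ x₁ ∧ x₃ ≤ x₂) ∨ (x₄ ≤ x₅ ∧ x₄ ≤ x₁ ∧ x₄ ≤ x₂ ∧ x₄ ≤ x₃) ∨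
      (x₅ ≤ x₁ ∧ x₅ ≤ x₂ ∧ x₅ ≤ x₃ ∧ x₅ ≤ x₄) := by omega
  rcases this with ⟨a, b, c, d⟩ | ⟨a, b, c, d⟩ | ⟨a, b, c, d⟩ | ⟨a, b, c, d⟩ | ⟨a, b, c, d⟩
  · exact key h (by omega) a b c d
  · exact (key (by omega) (by omega) a b c d).rotate.rotate.rotate.rotate
  · exact (key (by omega) (by omega) a b c d).rotate.rotate.rotate
  · exact (key (by omega) (by omega) a b c d).rotate.rotate
  · exact (key (by omega) (by omega) a b c d).rotate

/-! ### Frames: cyclically ordered robots, and the effect of moves on their gaps. -/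

variable {n : ℕ}

/-- The robots stand, in cyclic order, on the nodes `p 0, …, p 4`, and the `g k > 0` are the numbers
of edges between consecutive ones. -/
def IsFrame (p : Fin 5 → ZMod n) (g : Fin 5 → ℕ) : Prop :=
  (∀ k, 0 < g k) ∧ ∑ k, g k = n ∧ ∀ k, p (k + 1) = p k + (g k : ZMod n)

/-- Robot `k` may have a decision to move to the next node. -/
def MayAscend (g : Fin 5 → ℕ) (k : Fin 5) : Prop :=
  MayAdvance (g k) (g (k + 1)) (g (k + 2)) (g (k + 3)) (g (k + 4))

/-- Robot `k` may have a decision to move to the previous node. -/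
def MayDescend (g : Fin 5 → ℕ) (k : Fin 5) : Prop :=
  MayAdvance (g (k + 4)) (g (k + 3)) (g (k + 2)) (g (k + 1)) (g k)

/-- The robot on `p k` may have a (possibly outdated) decision to move to `v`. -/
def MayMove (p : Fin 5 → ZMod n) (g : Fin 5 → ℕ) (k : Fin 5) (v : ZMod n) : Prop :=
  (v = p k + 1 ∧ MayAscend g k) ∨ (v = p k - 1 ∧ MayDescend g k)

/-- At most `N` moves remain from a frame with gaps `g`. -/
def GapRank (g : Fin 5 → ℕ) (N : ℕ) : Prop := Rank (g 0) (g 1) (g 2) (g 3) (g 4) N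

/-- The gaps after robot `k` moved to the next node. -/
def ascend (g : Fin 5 → ℕ) (k : Fin 5) : Fin 5 → ℕ :=
  fun j => if j = k then g j - 1 else if j = k + 4 then g j + 1 else g j

/-- The gaps after robot `k` moved to the previous node. -/
def descend (g : Fin 5 → ℕ) (k : Fin 5) : Fin 5 → ℕ :=
  fun j => if j = k then g j + 1 else if j = k + 4 then g j - 1 else g j

theorem IsFrame.shift {p : Fin 5 → ZMod n} {g : Fin 5 → ℕ} (h : IsFrame p g) (r : Fin 5) :
    IsFrame (fun k => p (k + r)) (fun k => g (k + r)) := by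
  refine ⟨fun k => h.1 _, ?_, fun k => ?_⟩
  · rw [← h.2.1]
    exact Equiv.sum_comp (Equiv.addRight r) g
  · have := h.2.2 (k + r)
    rwa [add_right_comm] at this

theorem MayMove.shift_iff {p : Fin 5 → ZMod n} {g : Fin 5 → ℕ} {r k : Fin 5} {v : ZMod n} :
    MayMove (fun k => p (k + r)) (fun k => g (k + r)) k v ↔ MayMove p g (k + r) v := by
  simp only [MayMove, MayAscend, MayDescend, add_right_comm k r]

theorem GapRank.shift_iff {g : Fin 5 → ℕ} {N : ℕ} (r : Fin 5) :
    GapRank (fun k => g (k + r)) N ↔ GapRank g N := by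
  have h : ∀ g : Fin 5 → ℕ, GapRank g N → GapRank (fun k => g (k + 1)) N :=
    fun g h => Rank.rotate h
  have h'' : ∀ (r : Fin 5) (g : Fin 5 → ℕ), GapRank g N → GapRank (fun k => g (k + r)) N := by
    intro r g hg
    fin_cases r
    exacts [hg, h _ hg, h _ (h _ hg), h _ (h _ (h _ hg)), h _ (h _ (h _ (h _ hg)))]
  refine ⟨fun hg => ?_, h'' r g⟩
  have := h'' (-r) _ hg
  simpa only [neg_add_cancel_right] using this

theorem IsFrame.ascend {p : Fin 5 → ZMod n} {g : Fin 5 → ℕ} (h : IsFrame p g) {k : Fin 5}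
    (hk : 1 < g k) : IsFrame (Function.update p k (p k + 1)) (ascend g k) := by
  obtain ⟨h₁, h₂, h₃⟩ := h
  refine ⟨fun j => ?_, ?_, fun j => ?_⟩
  · unfold RingRobots.ascend
    have := h₁ j
    split_ifs <;> subst_vars <;> omega
  · rw [← h₂]
    simp only [Fin.sum_univ_five, RingRobots.ascend]
    fin_cases k <;> simp at hk ⊢ <;> omega
  · have h0 := h₃ j
    by_cases e : j = k
    · subst e
      have e1 : j + 1 ≠ j := (by decide : ∀ j : Fin 5, j + 1 ≠ j) j
      rw [Function.update_of_ne e1, Function.update_self, h0]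
      simp only [RingRobots.ascend, if_true]
      push_cast [Nat.cast_sub hk.le]
      ring
    · by_cases e' : j = k + 4
      · have e1 : j + 1 = k := e' ▸ (by decide : ∀ k : Fin 5, k + 4 + 1 = k) k
        rw [e1, Function.update_self, Function.update_of_ne e]
        rw [e1] at h0
        simp only [RingRobots.ascend, if_neg e, if_pos e', h0]
        push_cast
        ring
      · have e1 : j + 1 ≠ k := (by decide : ∀ j k : Fin 5, j ≠ k + 4 → j + 1 ≠ k) j k e'
        rw [Function.update_of_ne e1, Function.update_of_ne e, h0]
        simp only [RingRobots.ascend, if_neg e, if_neg e']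

theorem IsFrame.descend {p : Fin 5 → ZMod n} {g : Fin 5 → ℕ} (h : IsFrame p g) {k : Fin 5}
    (hk : 1 < g (k + 4)) : IsFrame (Function.update p k (p k - 1)) (descend g k) := by
  obtain ⟨h₁, h₂, h₃⟩ := h
  refine ⟨fun j => ?_, ?_, fun j => ?_⟩
  · unfold RingRobots.descend
    have := h₁ j
    split_ifs <;> subst_vars <;> omega
  · rw [← h₂]
    simp only [Fin.sum_univ_five, RingRobots.descend]
    fin_cases k <;> simp at hk ⊢ <;> omega
  · have h0 := h₃ j
    by_cases e : j = k
    · subst e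
      have e1 : j + 1 ≠ j := (by decide : ∀ j : Fin 5, j + 1 ≠ j) j
      rw [Function.update_of_ne e1, Function.update_self, h0]
      simp only [RingRobots.descend, if_true]
      push_cast
      ring
    · by_cases e' : j = k + 4
      · have e1 : j + 1 = k := e' ▸ (by decide : ∀ k : Fin 5, k + 4 + 1 = k) k
        rw [e1, Function.update_self, Function.update_of_ne e]
        rw [e1] at h0
        simp only [RingRobots.descend, if_neg e, if_pos e', h0]
        rw [← e'] at hk
        push_cast [Nat.cast_sub hk.le]
        ring
      · have e1 : j + 1 ≠ k := (by decide : ∀ j k : Fin 5, j ≠ k + 4 → j + 1 ≠ k) j k e'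
        rw [Function.update_of_ne e1, Function.update_of_ne e, h0]
        simp only [RingRobots.descend, if_neg e, if_neg e']

theorem MayAscend.ascend {g : Fin 5 → ℕ} {j k : Fin 5} (hjk : j ≠ k)
    (hj : MayAscend g j) (hk : MayAscend g k) : MayAscend (ascend g k) j := by
  fin_cases j <;> fin_cases k <;>
    first
    | exact absurd rfl hjk
    | exact hj.fwd₁ hk
    | exact hj.fwd₂ hk
    | exact hj.fwd₃ hk
    | exact hj.fwd₄ hk

theorem MayAscend.descend {g : Fin 5 → ℕ} {j k : Fin 5} (hjk : j ≠ k)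
    (hj : MayAscend g j) (hk : MayDescend g k) : MayAscend (descend g k) j := by
  fin_cases j <;> fin_cases k <;>
    first
    | exact absurd rfl hjk
    | exact hj.bwd₁ hk
    | exact hj.bwd₂ hk
    | exact hj.bwd₃ hk
    | exact hj.bwd₄ hk

theorem MayDescend.ascend {g : Fin 5 → ℕ} {j k : Fin 5} (hjk : j ≠ k)
    (hj : MayDescend g j) (hk : MayAscend g k) : MayDescend (ascend g k) j := by
  fin_cases j <;> fin_cases k <;>
    first
    | exact absurd rfl hjk
    | exact hj.bwd₁ hk
    | exact hj.bwd₂ hk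
    | exact hj.bwd₃ hk
    | exact hj.bwd₄ hk

theorem MayDescend.descend {g : Fin 5 → ℕ} {j k : Fin 5} (hjk : j ≠ k)
    (hj : MayDescend g j) (hk : MayDescend g k) : MayDescend (descend g k) j := by
  fin_cases j <;> fin_cases k <;>
    first
    | exact absurd rfl hjk
    | exact hj.fwd₁ hk
    | exact hj.fwd₂ hk
    | exact hj.fwd₃ hk
    | exact hj.fwd₄ hk

theorem GapRank.rank_from {g : Fin 5 → ℕ} {N : ℕ} (hN : GapRank g N) (k : Fin 5) :
    Rank (g k) (g (k + 1)) (g (k + 2)) (g (k + 3)) (g (k + 4)) N := by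
  have := (shift_iff k).2 hN
  fin_cases k <;> exact this

theorem GapRank.ascend {g : Fin 5 → ℕ} {k : Fin 5} {N : ℕ} (hN : GapRank g N) (hg : ∀ k, 0 < g k)
    (hk : MayAscend g k) : 0 < N ∧ GapRank (ascend g k) (N - 1) := by
  obtain ⟨h, h'⟩ := hk.rank (hN.rank_from k) (hg _) (hg _)
  refine ⟨h, (GapRank.shift_iff k).1 ?_⟩
  fin_cases k <;> exact h'

theorem GapRank.descend {g : Fin 5 → ℕ} {k : Fin 5} {N : ℕ} (hN : GapRank g N) (hg : ∀ k, 0 < g k)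
    (hk : MayDescend g k) : 0 < N ∧ GapRank (descend g k) (N - 1) := by
  obtain ⟨h, h'⟩ := hk.rank (hN.rank_from k).reverse (hg _) (hg _)
  refine ⟨h, (GapRank.shift_iff k).1 ?_⟩
  fin_cases k <;> exact h'.reverse

/-- A robot executes a decision: the decisions of the other robots remain admissible, and the rank
decreases. -/
theorem MayMove.step {p : Fin 5 → ZMod n} {g : Fin 5 → ℕ} {k : Fin 5} {w : ZMod n} {N : ℕ}
    (hF : IsFrame p g) (hN : GapRank g N) (hk : MayMove p g k w) :
    ∃ g', IsFrame (Function.update p k w) g' ∧ 0 < N ∧ GapRank g' (N - 1) ∧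
      ∀ j ≠ k, ∀ v, MayMove p g j v → MayMove (Function.update p k w) g' j v := by
  rcases hk with ⟨rfl, hk⟩ | ⟨rfl, hk⟩
  · obtain ⟨h, h'⟩ := hN.ascend hF.1 hk
    refine ⟨_, hF.ascend (hk.one_lt (hF.1 _) (hF.1 _)), h, h', fun j hj v hv => ?_⟩
    unfold MayMove
    rw [Function.update_of_ne hj]
    exact hv.imp (And.imp_right fun h => h.ascend hj hk) (And.imp_right fun h => h.ascend hj hk)
  · obtain ⟨h, h'⟩ := hN.descend hF.1 hk
    refine ⟨_, hF.descend (hk.one_lt (hF.1 _) (hF.1 _)), h, h', fun j hj v hv => ?_⟩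
    unfold MayMove
    rw [Function.update_of_ne hj]
    exact hv.imp (And.imp_right fun h => h.descend hj hk) (And.imp_right fun h => h.descend hj hk)

/-- Several robots execute decisions simultaneously. -/
theorem MayMove.simultaneous {p : Fin 5 → ZMod n} {g : Fin 5 → ℕ} {N : ℕ} (hF : IsFrame p g)
    (hN : GapRank g N) (O : Fin 5 → ZMod n → Prop) (hO : ∀ k v, O k v → MayMove p g k v)
    (p' : Fin 5 → ZMod n) (S : Finset (Fin 5)) (hS : ∀ k ∈ S, O k (p' k)) :
    ∃ g', IsFrame (fun k => if k ∈ S then p' k else p k) g' ∧ S.card ≤ N ∧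
      GapRank g' (N - S.card) ∧
      ∀ k ∉ S, ∀ v, O k v → MayMove (fun k => if k ∈ S then p' k else p k) g' k v := by
  induction S using Finset.induction_on with
  | empty => exact ⟨g, by simpa using hF, by simp, by simpa using hN, by simpa using hO⟩
  | insert k S hk ih =>
    obtain ⟨g', h₁, h₂, h₃, h₄⟩ := ih fun j hj => hS j (Finset.mem_insert_of_mem hj)
    obtain ⟨g'', f₁, f₂, f₃, f₄⟩ :=
      (h₄ k hk _ (hS k (Finset.mem_insert_self _ _))).step h₁ h₃
    have e : Function.update (fun k => if k ∈ S then p' k else p k) k (p' k) =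
        fun j => if j ∈ insert k S then p' j else p j := by
      funext j
      by_cases h : j = k
      · subst h; simp
      · simp [h]
    rw [e] at f₁ f₄
    refine ⟨g'', f₁, ?_, ?_, fun j hj v hv => ?_⟩
    · rw [Finset.card_insert_of_notMem hk]; omega
    · rwa [Finset.card_insert_of_notMem hk, Nat.sub_add_eq]
    · rw [Finset.mem_insert, not_or] at hj
      exact f₄ j hj.1 v (h₄ j hj.2 v hv)

/-! ### Occupation, distances and inter-distance in coordinates. -/

theorem occupied_multiplicity_iff {p : Fin 5 → ZMod n} {u : ZMod n} :
    Occupied (multiplicity p) u ↔ ∃ k, p k = u := by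
  simp [Occupied, multiplicity, Finset.card_pos, Finset.filter_nonempty_iff]

theorem multiplicity_comp_perm (p : Fin 5 → ZMod n) (σ : Equiv.Perm (Fin 5)) :
    multiplicity (p ∘ σ) = multiplicity p := by
  funext u
  unfold multiplicity
  refine Finset.card_bij (fun i _ => σ i) (by simp) (fun _ _ _ _ h => σ.injective h) fun j hj => ?_
  exact ⟨σ.symm j, by simpa using hj, by simp⟩

theorem hasTower_multiplicity_iff {p : Fin 5 → ZMod n} :
    HasTower (multiplicity p) ↔ ¬ Function.Injective p := by
  unfold HasTower multiplicity
  constructor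
  · rintro ⟨u, hu⟩ hp
    obtain ⟨a, ha, b, hb, hab⟩ := Finset.one_lt_card.1 hu
    simp only [Finset.mem_filter, Finset.mem_univ, true_and] at ha hb
    exact hab (hp (ha.trans hb.symm))
  · intro hp
    simp only [Function.Injective, not_forall] at hp
    obtain ⟨a, b, h, hab⟩ := hp
    exact ⟨p a, Finset.one_lt_card.2 ⟨a, by simp, b, by simp [h], hab⟩⟩

theorem natCast_eq_natCast_of_lt {x y : ℕ} (hx : x < n) (hy : y < n)
    (h : (x : ZMod n) = (y : ZMod n)) : x = y := by
  rw [ZMod.natCast_eq_natCast_iff] at h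
  exact Nat.ModEq.eq_of_lt_of_lt h hx hy

theorem ringDist_comm (u v : ZMod n) : ringDist u v = ringDist v u := min_comm _ _

theorem ringDist_coord (b : ZMod n) {x y : ℕ} (hx : x < n) (hy : y < n) :
    ringDist (b + (x : ZMod n)) (b + (y : ZMod n)) =
      min ((x - y) + (y - x)) (n - ((x - y) + (y - x))) := by
  have key : ∀ {x y : ℕ}, x ≤ y → y < n →
      ringDist (b + (x : ZMod n)) (b + (y : ZMod n)) = min (y - x) (n - (y - x)) := by
    intro x y hxy hy
    have : NeZero n := ⟨by omega⟩
    have h₁ : b + (y : ZMod n) - (b + (x : ZMod n)) = ((y - x : ℕ) : ZMod n) := by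
      push_cast [Nat.cast_sub hxy]; ring
    have h₂ : b + (x : ZMod n) - (b + (y : ZMod n)) = ((n - (y - x) : ℕ) : ZMod n) := by
      rw [Nat.cast_sub (by omega), ZMod.natCast_self, Nat.cast_sub hxy]; ring
    rw [ringDist, h₁, h₂, ZMod.val_natCast_of_lt (show y - x < n by omega)]
    rcases hxy.eq_or_lt with rfl | h
    · simp
    · rw [ZMod.val_natCast_of_lt (by omega), min_comm]
  rcases le_total x y with h | h
  · rw [key h hy]; congr 1 <;> omega
  · rw [ringDist_comm, key h hx]; congr 1 <;> omega

/-- The distance to a set of nodes that spreads from `b + lo` to `b + hi`. -/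
theorem distTo_coord {b : ZMod n} {B : Finset (ZMod n)} {lo hi y : ℕ}
    (hlo : b + (lo : ZMod n) ∈ B) (hhi : b + (hi : ZMod n) ∈ B)
    (hB : ∀ v ∈ B, ∃ z : ℕ, lo ≤ z ∧ z ≤ hi ∧ v = b + (z : ZMod n)) (hy : hi ≤ y) (hyn : y < n) :
    distTo (b + (y : ZMod n)) B = min (y - hi) (n - y + lo) := by
  obtain ⟨z₀, h₁, h₂, -⟩ := hB _ hhi
  have key : ∀ z, z ≤ hi → ringDist (b + (y : ZMod n)) (b + (z : ZMod n)) =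
      min (y - z) (n - (y - z)) := by
    intro z hz
    rw [ringDist_coord b hyn (by omega)]; congr 1 <;> omega
  apply le_antisymm
  · have e₁ : distTo (b + (y : ZMod n)) B ≤ _ := Nat.sInf_le ⟨_, hlo, rfl⟩
    have e₂ : distTo (b + (y : ZMod n)) B ≤ _ := Nat.sInf_le ⟨_, hhi, rfl⟩
    rw [key _ (by omega)] at e₁ e₂
    omega
  · refine le_csInf ⟨_, _, hlo, rfl⟩ ?_
    rintro k ⟨v, hv, rfl⟩
    obtain ⟨z, hz₁, hz₂, rfl⟩ := hB v hv
    rw [key z hz₂]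
    omega

theorem toward_coord_iff {b v : ZMod n} {B : Finset (ZMod n)} {lo hi y : ℕ}
    (hlo : b + (lo : ZMod n) ∈ B) (hhi : b + (hi : ZMod n) ∈ B)
    (hB : ∀ v ∈ B, ∃ z : ℕ, lo ≤ z ∧ z ≤ hi ∧ v = b + (z : ZMod n)) (hy : hi < y)
    (hyn : y + 1 < n) :
    Toward (b + (y : ZMod n)) B v ↔
      (v = b + (y : ZMod n) + 1 ∧ n - y + lo ≤ y - hi) ∨
        (v = b + (y : ZMod n) - 1 ∧ y - hi ≤ n - y + lo) := by
  have e₁ : b + (y : ZMod n) + 1 = b + ((y + 1 : ℕ) : ZMod n) := by push_cast; ring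
  have e₂ : b + (y : ZMod n) - 1 = b + ((y - 1 : ℕ) : ZMod n) := by
    push_cast [Nat.cast_sub (show 1 ≤ y by omega)]; ring
  have d₀ := distTo_coord hlo hhi hB (y := y) (by omega) (by omega)
  have d₁ := distTo_coord hlo hhi hB (y := y + 1) (by omega) (by omega)
  have d₂ := distTo_coord hlo hhi hB (y := y - 1) (by omega) (by omega)
  constructor
  · rintro ⟨rfl | rfl, h⟩
    · rw [e₁, d₀, d₁] at h
      exact Or.inl ⟨rfl, by omega⟩
    · rw [e₂, d₀, d₂] at h
      exact Or.inr ⟨rfl, by omega⟩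
  · rintro (⟨rfl, h⟩ | ⟨rfl, h⟩)
    · refine ⟨Or.inl rfl, ?_⟩
      rw [e₁, d₀, d₁]; omega
    · refine ⟨Or.inr rfl, ?_⟩
      rw [e₂, d₀, d₂]; omega

namespace IsFrame

variable {p : Fin 5 → ZMod n} {g : Fin 5 → ℕ}

theorem sum_eq (h : IsFrame p g) : g 0 + g 1 + g 2 + g 3 + g 4 = n := by
  rw [← h.2.1, Fin.sum_univ_five]

theorem coord₁ (h : IsFrame p g) : p 1 = p 0 + ((g 0 : ℕ) : ZMod n) := h.2.2 0

theorem coord₂ (h : IsFrame p g) : p 2 = p 0 + ((g 0 + g 1 : ℕ) : ZMod n) := by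
  rw [show p 2 = p 1 + _ from h.2.2 1, h.coord₁]; push_cast; ring

theorem coord₃ (h : IsFrame p g) : p 3 = p 0 + ((g 0 + g 1 + g 2 : ℕ) : ZMod n) := by
  rw [show p 3 = p 2 + _ from h.2.2 2, h.coord₂]; push_cast; ring

theorem coord₄ (h : IsFrame p g) : p 4 = p 0 + ((g 0 + g 1 + g 2 + g 3 : ℕ) : ZMod n) := by
  rw [show p 4 = p 3 + _ from h.2.2 3, h.coord₃]; push_cast; ring

/-- The offset of a robot from the first one. -/
theorem exists_offset (h : IsFrame p g) : ∃ x : Fin 5 → ℕ,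
    (∀ k, p k = p 0 + (x k : ZMod n)) ∧ x 0 = 0 ∧ x 1 = g 0 ∧ x 2 = g 0 + g 1 ∧
    x 3 = g 0 + g 1 + g 2 ∧ x 4 = g 0 + g 1 + g 2 + g 3 := by
  refine ⟨![0, g 0, g 0 + g 1, g 0 + g 1 + g 2, g 0 + g 1 + g 2 + g 3], fun k => ?_,
    rfl, rfl, rfl, rfl, rfl⟩
  fin_cases k
  exacts [by simp, h.coord₁, h.coord₂, h.coord₃, h.coord₄]

theorem offset_ne (h : IsFrame p g) {k : Fin 5} {j : ℕ} (h₀ : 0 < j) (hj : j < g k) (i : Fin 5) :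
    p i ≠ p k + (j : ZMod n) := by
  have key : ∀ {p : Fin 5 → ZMod n} {g : Fin 5 → ℕ}, IsFrame p g → j < g 0 → ∀ i,
      p i ≠ p 0 + (j : ZMod n) := by
    intro p g h hj i e
    obtain ⟨x, hx, x0, x1, x2, x3, x4⟩ := h.exists_offset
    have hs := h.sum_eq
    have hp := h.1
    have := hp 1; have := hp 2; have := hp 3; have := hp 4
    rw [hx i, add_right_inj] at e
    have hxi : x i < n ∧ x i ≠ j := by fin_cases i <;> simp <;> omega
    exact hxi.2 (natCast_eq_natCast_of_lt hxi.1 (by omega) e)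
  have := key (h.shift k) (by simpa using hj) (i - k)
  simpa using this

theorem injective (h : IsFrame p g) : Function.Injective p := by
  intro i j e
  obtain ⟨x, hx, x0, x1, x2, x3, x4⟩ := h.exists_offset
  have hs := h.sum_eq
  have h0 := h.1 0; have h1 := h.1 1; have h2 := h.1 2; have h3 := h.1 3; have h4 := h.1 4
  rw [hx i, hx j, add_right_inj] at e
  have hxl : ∀ i, x i < n := by intro i; fin_cases i <;> simp <;> omega
  have := natCast_eq_natCast_of_lt (hxl i) (hxl j) e
  fin_cases i <;> fin_cases j <;> first | rfl | (exfalso; simp at this; omega)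

theorem not_hasTower (h : IsFrame p g) : ¬ HasTower (multiplicity p) := by
  rw [hasTower_multiplicity_iff, not_not]; exact h.injective

theorem not_occupied (h : IsFrame p g) {k : Fin 5} {j : ℕ} (h₀ : 0 < j) (hj : j < g k) :
    ¬ Occupied (multiplicity p) (p k + (j : ZMod n)) := by
  rw [occupied_multiplicity_iff]
  rintro ⟨i, hi⟩
  exact h.offset_ne h₀ hj i hi

theorem occupied (k : Fin 5) : Occupied (multiplicity p) (p k) :=
  occupied_multiplicity_iff.2 ⟨k, rfl⟩

theorem interDist_eq (h : IsFrame p g) {d : ℕ} (hd : ∀ k, d ≤ g k) {k₀ : Fin 5} (hk₀ : g k₀ = d) :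
    interDist (multiplicity p) = d := by
  obtain ⟨x, hx, x0, x1, x2, x3, x4⟩ := h.exists_offset
  have hs := h.sum_eq
  have h0 := h.1 0; have h1 := h.1 1; have h2 := h.1 2; have h3 := h.1 3; have h4 := h.1 4
  have d0 := hd 0; have d1 := hd 1; have d2 := hd 2; have d3 := hd 3; have d4 := hd 4
  have hxl : ∀ i, x i < n := by intro i; fin_cases i <;> simp <;> omega
  have hD : ∀ i j, ringDist (p i) (p j) =
      min ((x i - x j) + (x j - x i)) (n - ((x i - x j) + (x j - x i))) := by
    intro i j
    rw [hx i, hx j, ringDist_coord _ (hxl i) (hxl j)]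
  refine le_antisymm (Nat.sInf_le ⟨p k₀, p (k₀ + 1), occupied _, occupied _, Or.inl ?_, ?_⟩)
    (le_csInf ⟨_, p 0, p 1, occupied _, occupied _, Or.inl (h.injective.ne (by decide)), rfl⟩ ?_)
  · exact h.injective.ne ((by decide : ∀ k : Fin 5, k ≠ k + 1) k₀)
  · rw [hD]
    fin_cases k₀ <;> simp at hk₀ ⊢ <;> omega
  · rintro k ⟨u, v, hu, hv, huv, rfl⟩
    obtain ⟨i, rfl⟩ := occupied_multiplicity_iff.1 hu
    obtain ⟨j, rfl⟩ := occupied_multiplicity_iff.1 hv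
    have hij : i ≠ j := by
      rintro rfl
      exact h.not_hasTower ⟨_, huv.resolve_left (fun h => h rfl)⟩
    rw [hD]
    fin_cases i <;> fin_cases j <;> first | exact absurd rfl hij | (simp; omega)

end IsFrame

/-! ### Blocks as arcs of robot indices. -/

/-- The `m` consecutive indices from `k` on. -/
def arc (k : Fin 5) (m : ℕ) : Finset (Fin 5) :=
  (Finset.range m).image fun i => k + Fin.ofNat 5 i

/-- The arcs of at least two indices all of whose steps belong to `M`. -/
def IsArc (M : Finset (Fin 5)) (A : Finset (Fin 5)) : Prop :=
  ∃ k : Fin 5, ∃ m ∈ Finset.Icc 2 5, (∀ i ∈ Finset.range (m - 1), k + Fin.ofNat 5 i ∈ M) ∧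
    A = arc k m

instance (M A : Finset (Fin 5)) : Decidable (IsArc M A) := by unfold IsArc; infer_instance

/-- Up to rotation the set of minimal gaps, nonempty and proper, has six possible patterns; each is
settled by enumeration. -/
theorem maximal_isArc_one (A : Finset (Fin 5)) : Maximal (IsArc {0}) A ↔ A = {0, 1} := by
  unfold Maximal; revert A; decide +kernel

theorem maximal_isArc_two (A : Finset (Fin 5)) : Maximal (IsArc {0, 1}) A ↔ A = {0, 1, 2} := by
  unfold Maximal; revert A; decide +kernel

theorem maximal_isArc_three (A : Finset (Fin 5)) :
    Maximal (IsArc {0, 1, 2}) A ↔ A = {0, 1, 2, 3} := by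
  unfold Maximal; revert A; decide +kernel

theorem maximal_isArc_four (A : Finset (Fin 5)) :
    Maximal (IsArc {0, 1, 2, 3}) A ↔ A = {0, 1, 2, 3, 4} := by
  unfold Maximal; revert A; decide +kernel

theorem maximal_isArc_two_one (A : Finset (Fin 5)) :
    Maximal (IsArc {0, 1, 3}) A ↔ A = {0, 1, 2} ∨ A = {3, 4} := by
  unfold Maximal; revert A; decide +kernel

theorem maximal_isArc_one_one (A : Finset (Fin 5)) :
    Maximal (IsArc {0, 2}) A ↔ A = {0, 1} ∨ A = {2, 3} := by
  unfold Maximal; revert A; decide +kernel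

theorem IsFrame.pos_add {p : Fin 5 → ZMod n} {g : Fin 5 → ℕ} (h : IsFrame p g) {d : ℕ} {k : Fin 5}
    (i : ℕ) (hi : ∀ j < i, g (k + Fin.ofNat 5 j) = d) :
    p (k + Fin.ofNat 5 i) = p k + ((i * d : ℕ) : ZMod n) := by
  induction i with
  | zero => simp
  | succ i ih =>
    have e : k + Fin.ofNat 5 (i + 1) = k + Fin.ofNat 5 i + 1 := by
      rw [add_assoc]; congr 1; ext; simp [Fin.val_add]
    rw [e, h.2.2, ih fun j hj => hi j (by omega), hi i (by omega)]
    push_cast; ring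

/-- This moves the search for blocks from the ring to the finite set of indices, where it is
decidable. -/
theorem IsFrame.isSpacedPath_iff {p : Fin 5 → ZMod n} {g : Fin 5 → ℕ} (h : IsFrame p g) {d : ℕ}
    (hd : 0 < d) {B : Finset (ZMod n)} :
    IsSpacedPath (multiplicity p) d B ↔
      ∃ A, IsArc (Finset.univ.filter fun k => g k = d) A ∧ B = A.image p := by
  have hst : ∀ (k : Fin 5) (m : ℕ), (∀ j < m - 1, g (k + Fin.ofNat 5 j) = d) →
      stations d (p k) m = (arc k m).image p := by
    intro k m hm
    unfold stations arc
    rw [Finset.image_image]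
    refine Finset.image_congr fun i hi => ?_
    have hi := Finset.mem_range.1 hi
    exact (h.pos_add i fun j hj => hm j (by omega)).symm
  constructor
  · rintro ⟨u, m, hm, hlt, hocc, rfl⟩
    obtain ⟨k, rfl⟩ : ∃ k, p k = u := by
      rw [← occupied_multiplicity_iff]
      simpa using (hocc 0 (Nat.zero_le _)).2 (dvd_zero d)
    have hg : ∀ i, i < m - 1 → g (k + Fin.ofNat 5 i) = d := by
      intro i
      induction i using Nat.strong_induction_on with
      | _ i ih =>
        intro hi
        have hp := h.pos_add (k := k) i fun j hj => ih j hj (by omega)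
        have hmul : i * d + d ≤ (m - 1) * d := by
          rw [← Nat.succ_mul]; exact Nat.mul_le_mul_right _ hi
        have hgp := h.1 (k + Fin.ofNat 5 i)
        -- A shorter gap puts a robot strictly between two stations; a longer one leaves the next
        -- station empty.
        rcases lt_trichotomy (g (k + Fin.ofNat 5 i)) d with hlt' | heq | hgt
        · exfalso
          have hdv : d ∣ i * d + g (k + Fin.ofNat 5 i) := by
            refine (hocc _ (by omega)).1 ?_
            push_cast
            rw [← add_assoc, ← Nat.cast_mul, ← hp, ← h.2.2]
            exact occupied _
          rw [Nat.dvd_add_right (dvd_mul_left d i)] at hdv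
          exact absurd (Nat.le_of_dvd hgp hdv) (by omega)
        · exact heq
        · exfalso
          refine h.not_occupied hd hgt ?_
          rw [hp, add_assoc, ← Nat.cast_add]
          exact (hocc _ hmul).2 (Dvd.intro_left (i + 1) (by ring))
    -- Six stations would force all gaps to equal `d`, hence `n = 5 * d`, and the path would close
    -- up on itself.
    have hm5 : m ≤ 5 := by
      by_contra hm5
      have h5 : ∀ k', g k' = d := by
        intro k'
        have := hg (k' - k).val (by omega)
        rwa [show k + Fin.ofNat 5 (k' - k).val = k' by simp] at this
      have hs := h.sum_eq
      simp only [h5] at hs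
      have : 5 * d ≤ (m - 1) * d := Nat.mul_le_mul_right _ (by omega)
      omega
    refine ⟨arc k m, ⟨k, m, by simp [hm, hm5], ?_, rfl⟩, hst k m hg⟩
    simpa using hg
  · rintro ⟨A, ⟨k, m, hm, hg, rfl⟩, rfl⟩
    simp only [Finset.mem_Icc, Finset.mem_range, Finset.mem_filter, Finset.mem_univ, true_and]
      at hm hg
    refine ⟨p k, m, hm.1, ?_, ?_, (hst k m hg).symm⟩
    · have hs := h.2.1
      rw [← Equiv.sum_comp (Equiv.addLeft k) g, Fin.sum_univ_five] at hs
      have h0 := h.1 (k + 0); have h1 := h.1 (k + 1); have h2 := h.1 (k + 2)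
      have h3 := h.1 (k + 3); have h4 := h.1 (k + 4)
      have e0 := hg 0; have e1 := hg 1; have e2 := hg 2; have e3 := hg 3
      simp only [Equiv.coe_addLeft] at hs
      change _ → g (k + 0) = d at e0
      change _ → g (k + 1) = d at e1
      change _ → g (k + 2) = d at e2
      change _ → g (k + 3) = d at e3
      obtain ⟨hm1, hm2⟩ := hm
      interval_cases m <;> simp at e0 e1 e2 e3 h0 hs ⊢ <;> omega
    · intro j hj
      have hdm := Nat.div_add_mod j d
      have hjd : j / d ≤ m - 1 := Nat.div_le_of_le_mul (by rwa [mul_comm])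
      have hp := h.pos_add (j / d) fun i hi => hg i (by omega)
      have e : p k + (j : ZMod n) = p (k + Fin.ofNat 5 (j / d)) + ((j % d : ℕ) : ZMod n) := by
        rw [hp, add_assoc, ← Nat.cast_add, mul_comm, hdm]
      rw [e, Nat.dvd_iff_mod_eq_zero]
      constructor
      · intro ho
        by_contra hne
        have hlt : j / d < m - 1 := by
          by_contra hnl
          have : j / d = m - 1 := by omega
          rw [this, mul_comm] at hdm
          omega
        refine h.not_occupied (Nat.pos_of_ne_zero hne) ?_ ho
        rw [hg _ hlt]; exact Nat.mod_lt _ hd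
      · intro h0
        rw [h0]; simpa using occupied _

theorem IsFrame.isBlock_iff {p : Fin 5 → ZMod n} {g : Fin 5 → ℕ} (h : IsFrame p g) {d : ℕ}
    (hd : 0 < d) {B : Finset (ZMod n)} :
    IsBlock (multiplicity p) d B ↔
      ∃ A, Maximal (IsArc (Finset.univ.filter fun k => g k = d)) A ∧ B = A.image p := by
  unfold IsBlock Maximal
  constructor
  · rintro ⟨h₁, h₂⟩
    obtain ⟨A, hA, rfl⟩ := (h.isSpacedPath_iff hd).1 h₁
    refine ⟨A, ⟨hA, fun A' hA' hle => ?_⟩, rfl⟩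
    have := h₂ ((h.isSpacedPath_iff hd).2 ⟨A', hA', rfl⟩) (Finset.image_mono p hle)
    exact (Finset.image_subset_image_iff h.injective).1 this
  · rintro ⟨A, ⟨hA, hmax⟩, rfl⟩
    refine ⟨(h.isSpacedPath_iff hd).2 ⟨A, hA, rfl⟩, fun B' hB' hle => ?_⟩
    obtain ⟨A', hA', rfl⟩ := (h.isSpacedPath_iff hd).1 hB'
    exact Finset.image_mono p (hmax hA' ((Finset.image_subset_image_iff h.injective).1 hle))

/-! ### The rules of the Block Module expressed by robot indices. -/

variable {p : Fin 5 → ZMod n} {g : Fin 5 → ℕ}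

theorem isolated_iff (hp : Function.Injective p) {𝒜 : Set (Finset (Fin 5))}
    (hB : ∀ B, IsBlock (multiplicity p) (interDist (multiplicity p)) B ↔
      ∃ A ∈ 𝒜, B = A.image p) (u : ZMod n) :
    Isolated (multiplicity p) u ↔ ∃ k, p k = u ∧ ∀ A ∈ 𝒜, k ∉ A := by
  unfold Isolated
  rw [occupied_multiplicity_iff]
  constructor
  · rintro ⟨⟨k, rfl⟩, h⟩
    refine ⟨k, rfl, fun A hA hk => ?_⟩
    exact h _ ((hB _).2 ⟨A, hA, rfl⟩) (Finset.mem_image_of_mem p hk)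
  · rintro ⟨k, rfl, h⟩
    refine ⟨⟨k, rfl⟩, fun B hB' hk => ?_⟩
    obtain ⟨A, hA, rfl⟩ := (hB B).1 hB'
    obtain ⟨j, hj, e⟩ := Finset.mem_image.1 hk
    exact h A hA (hp e ▸ hj)

theorem blockModule_iff_of_isolated_of_single (hp : Function.Injective p) {A : Finset (Fin 5)}
    (hB : ∀ B, IsBlock (multiplicity p) (interDist (multiplicity p)) B ↔ B = A.image p)
    (hA : ∃ j, j ∉ A) (k : Fin 5) (v : ZMod n) :
    BlockModule (multiplicity p) (p k) v ↔
      k ∉ A ∧ (∀ j ∉ A, distTo (p k) (A.image p) ≤ distTo (p j) (A.image p)) ∧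
        Toward (p k) (A.image p) v := by
  have hI : ∀ j, Isolated (multiplicity p) (p j) ↔ j ∉ A := by
    intro j
    rw [isolated_iff hp (𝒜 := {A}) (by simpa using hB)]
    simp [hp.eq_iff]
  constructor
  · rintro (⟨B, single, me, closest, move⟩ | ⟨B₁, B₂, ne, two, -, -, -⟩ |
      ⟨B₁, B₂, ne, two, -, -, -, -⟩ | ⟨B, noIso, -, -, -, -, -, -, -⟩ |
      ⟨S, L, noIso, -, -, -, -, -⟩)
    · obtain rfl := (hB B).1 ((single B).2 rfl)
      exact ⟨(hI k).1 me, fun j hj => closest _ ((hI j).2 hj), move⟩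
    · exact absurd (((hB B₁).1 ((two B₁).2 (Or.inl rfl))).trans
        ((hB B₂).1 ((two B₂).2 (Or.inr rfl))).symm) ne
    · exact absurd (((hB B₁).1 ((two B₁).2 (Or.inl rfl))).trans
        ((hB B₂).1 ((two B₂).2 (Or.inr rfl))).symm) ne
    · obtain ⟨j, hj⟩ := hA
      exact absurd ((hI j).2 hj) (noIso _)
    · obtain ⟨j, hj⟩ := hA
      exact absurd ((hI j).2 hj) (noIso _)
  · rintro ⟨hk, closest, move⟩
    refine .isolatedSingle _ hB ((hI k).2 hk) (fun w hw => ?_) move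
    obtain ⟨j, rfl⟩ := occupied_multiplicity_iff.1 hw.1
    exact closest j ((hI j).1 hw)

theorem isBlock_eq_or {c : ZMod n → ℕ} {d : ℕ} {I₁ I₂ B₁ B₂ : Finset (ZMod n)} (ne : B₁ ≠ B₂)
    (hB : ∀ B, IsBlock c d B ↔ B = I₁ ∨ B = I₂) (two : ∀ B, IsBlock c d B ↔ B = B₁ ∨ B = B₂) :
    B₁ = I₁ ∧ B₂ = I₂ ∨ B₁ = I₂ ∧ B₂ = I₁ := by
  have h₁ := (hB B₁).1 ((two B₁).2 (Or.inl rfl))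
  have h₂ := (hB B₂).1 ((two B₂).2 (Or.inr rfl))
  grind

theorem not_single_of_two {c : ZMod n → ℕ} {d : ℕ} {I₁ I₂ B : Finset (ZMod n)} (ne : I₁ ≠ I₂)
    (hB : ∀ B, IsBlock c d B ↔ B = I₁ ∨ B = I₂) (single : ∀ B', IsBlock c d B' ↔ B' = B) : False :=
  ne (((single _).1 ((hB I₁).2 (Or.inl rfl))).trans ((single _).1 ((hB I₂).2 (Or.inr rfl))).symm)

theorem BlockModule.of_isolated_of_two (hp : Function.Injective p) {A₁ A₂ : Finset (Fin 5)}
    (ne : A₁ ≠ A₂)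
    (hB : ∀ B, IsBlock (multiplicity p) (interDist (multiplicity p)) B ↔
      B = A₁.image p ∨ B = A₂.image p)
    (hA : ∃ j, j ∉ A₁ ∧ j ∉ A₂) {k : Fin 5} {v : ZMod n}
    (h : BlockModule (multiplicity p) (p k) v) :
    (k ∉ A₁ ∧ k ∉ A₂) ∧
      ((Symmetric (multiplicity p) ∧ (Toward (p k) (A₁.image p) v ∨ Toward (p k) (A₂.image p) v)) ∨
        (distTo (p k) (A₁.image p) ≤ distTo (p k) (A₂.image p) ∧ Toward (p k) (A₁.image p) v) ∨
        (distTo (p k) (A₂.image p) ≤ distTo (p k) (A₁.image p) ∧ Toward (p k) (A₂.image p) v)) := by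
  have ne' : A₁.image p ≠ A₂.image p := (Finset.image_injective hp).ne ne
  have hI : ∀ j, Isolated (multiplicity p) (p j) ↔ j ∉ A₁ ∧ j ∉ A₂ := by
    intro j
    rw [isolated_iff hp (𝒜 := {A₁, A₂}) (by simpa using hB)]
    simp [hp.eq_iff]
  obtain ⟨j, hj⟩ := hA
  rcases h with ⟨B, single, -, -, -⟩ | ⟨B₁, B₂, ne, two, symm, me, move⟩ |
    ⟨B₁, B₂, ne, two, asymm, me, closest, move⟩ | ⟨B, noIso, -, -, -, -, -, -, -⟩ |
    ⟨S, L, noIso, -, -, -, -, -⟩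
  · exact (not_single_of_two ne' hB single).elim
  · refine ⟨(hI k).1 me, Or.inl ⟨symm, ?_⟩⟩
    rcases isBlock_eq_or ne hB two with ⟨rfl, rfl⟩ | ⟨rfl, rfl⟩
    exacts [Or.inl move, Or.inr move]
  · refine ⟨(hI k).1 me, Or.inr ?_⟩
    rcases isBlock_eq_or ne hB two with ⟨rfl, rfl⟩ | ⟨rfl, rfl⟩
    exacts [Or.inl ⟨closest, move⟩, Or.inr ⟨closest, move⟩]
  · exact absurd ((hI j).2 hj) (noIso _)
  · exact absurd ((hI j).2 hj) (noIso _)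

/-- Used for progress: the closer block is a legal choice whether or not the configuration is
symmetric. -/
theorem blockModule_of_isolated_of_two (hp : Function.Injective p) {A₁ A₂ : Finset (Fin 5)}
    (ne : A₁ ≠ A₂)
    (hB : ∀ B, IsBlock (multiplicity p) (interDist (multiplicity p)) B ↔
      B = A₁.image p ∨ B = A₂.image p) {k : Fin 5} {v : ZMod n} (hk : k ∉ A₁ ∧ k ∉ A₂)
    (closest : distTo (p k) (A₁.image p) ≤ distTo (p k) (A₂.image p))
    (move : Toward (p k) (A₁.image p) v) : BlockModule (multiplicity p) (p k) v := by
  have ne' : A₁.image p ≠ A₂.image p := (Finset.image_injective hp).ne ne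
  have me : Isolated (multiplicity p) (p k) := by
    rw [isolated_iff hp (𝒜 := {A₁, A₂}) (by simpa using hB)]
    exact ⟨k, rfl, by simpa using hk⟩
  by_cases symm : Symmetric (multiplicity p)
  · exact .isolatedTwoSymmetric _ _ ne' hB symm me move
  · exact .isolatedTwoAsymmetric _ _ ne' hB symm me closest move

theorem blockModule_iff_of_two (hp : Function.Injective p) {A₁ A₂ : Finset (Fin 5)}
    (hcard : A₂.card < A₁.card)
    (hB : ∀ B, IsBlock (multiplicity p) (interDist (multiplicity p)) B ↔
      B = A₁.image p ∨ B = A₂.image p)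
    (hA : ∀ j, j ∈ A₁ ∨ j ∈ A₂) (k : Fin 5) (v : ZMod n) :
    BlockModule (multiplicity p) (p k) v ↔
      k ∈ A₂ ∧ (∀ j ∈ A₂, distTo (p k) (A₁.image p) ≤ distTo (p j) (A₁.image p)) ∧
        Toward (p k) (A₁.image p) v := by
  have ne' : A₁.image p ≠ A₂.image p :=
    (Finset.image_injective hp).ne fun h => hcard.ne (congrArg _ h.symm)
  have hI : ∀ u, ¬ Isolated (multiplicity p) u := by
    intro u
    rw [isolated_iff hp (𝒜 := {A₁, A₂}) (by simpa using hB)]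
    rintro ⟨j, -, h⟩
    rcases hA j with hj | hj
    exacts [h _ (by simp) hj, h _ (by simp) hj]
  constructor
  · rintro (⟨B, single, me, -, -⟩ | ⟨B₁, B₂, ne, two, -, me, -⟩ | ⟨B₁, B₂, ne, two, -, me, -, -⟩ |
      ⟨B, -, single, -, -, -, -, -, -⟩ | ⟨S, L, -, two, smaller, me, closest, move⟩)
    · exact absurd me (hI _)
    · exact absurd me (hI _)
    · exact absurd me (hI _)
    · exact (not_single_of_two ne' hB single).elim
    · rcases isBlock_eq_or (fun h => smaller.ne (congrArg _ h)) hB two with ⟨rfl, rfl⟩ | ⟨rfl, rfl⟩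
      · rw [Finset.card_image_of_injective _ hp, Finset.card_image_of_injective _ hp] at smaller
        omega
      · refine ⟨?_, fun j hj => closest _ (Finset.mem_image_of_mem p hj), move⟩
        obtain ⟨j, hj, e⟩ := Finset.mem_image.1 me
        exact hp e ▸ hj
  · rintro ⟨hk, closest, move⟩
    refine .twoBlocks (A₂.image p) (A₁.image p) hI (fun B => (hB B).trans or_comm) ?_
      (Finset.mem_image_of_mem p hk) (fun w hw => ?_) move
    · rwa [Finset.card_image_of_injective _ hp, Finset.card_image_of_injective _ hp]
    · obtain ⟨j, hj, rfl⟩ := Finset.mem_image.1 hw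
      exact closest j hj

theorem BlockModule.of_univ (hp : Function.Injective p)
    (hB : ∀ B, IsBlock (multiplicity p) (interDist (multiplicity p)) B ↔ B = Finset.univ.image p)
    {u v : ZMod n} (h : BlockModule (multiplicity p) u v) :
    1 < interDist (multiplicity p) ∧ ∃ e : ZMod n, (e = 1 ∨ e = -1) ∧
      (∀ j : ℕ, 1 ≤ j → j ≤ interDist (multiplicity p) →
        ¬ Occupied (multiplicity p) (u + e * (j : ZMod n))) ∧ v = u - e := by
  have hI : ∀ u, ¬ Isolated (multiplicity p) u := by
    intro u
    rw [isolated_iff hp (𝒜 := {Finset.univ}) (by simpa using hB)]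
    rintro ⟨j, -, h⟩
    exact h _ rfl (Finset.mem_univ j)
  rcases h with ⟨B, single, me, -, -⟩ | ⟨B₁, B₂, ne, two, -, me, -⟩ |
    ⟨B₁, B₂, ne, two, -, me, -, -⟩ | ⟨B, -, single, large, me, e, side, hole, move⟩ |
    ⟨S, L, -, two, smaller, me, closest, move⟩
  · exact absurd me (hI _)
  · exact absurd me (hI _)
  · exact absurd me (hI _)
  · exact ⟨large, e, side, hole, move⟩
  · have := ((hB S).1 ((two S).2 (Or.inl rfl))).trans ((hB L).1 ((two L).2 (Or.inr rfl))).symm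
    exact absurd (congrArg Finset.card this) smaller.ne

/-! ### Soundness and progress for each pattern of minimal gaps. -/

/-- All decisions of the Block Module are admissible, and somebody moves unless the robots form a
single `1`.block. -/
def Sound (p : Fin 5 → ZMod n) (g : Fin 5 → ℕ) : Prop :=
  (∀ k v, BlockModule (multiplicity p) (p k) v → MayMove p g k v) ∧
    (¬ IsSingleOneBlock (multiplicity p) → ∃ k v, BlockModule (multiplicity p) (p k) v)

theorem Sound.of_shift {r : Fin 5} (h : Sound (fun k => p (k + r)) (fun k => g (k + r))) :
    Sound p g := by
  have e : multiplicity (fun k => p (k + r)) = multiplicity p :=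
    multiplicity_comp_perm p (Equiv.addRight r)
  obtain ⟨h₁, h₂⟩ := h
  rw [e] at h₁ h₂
  refine ⟨fun k v hb => ?_, fun hs => ?_⟩
  · have := h₁ (k - r) v (by simpa using hb)
    rw [MayMove.shift_iff] at this
    simpa using this
  · obtain ⟨k, v, h⟩ := h₂ hs
    exact ⟨_, v, h⟩

section Offsets

variable {b v : ZMod n} {x : Fin 5 → ℕ} {A : Finset (Fin 5)} {i j k : Fin 5}

theorem distTo_image (hx : ∀ k, p k = b + (x k : ZMod n)) (hi : i ∈ A) (hj : j ∈ A)
    (hA : ∀ k ∈ A, x i ≤ x k ∧ x k ≤ x j) (hk : x j ≤ x k) (hkn : x k < n) :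
    distTo (p k) (A.image p) = min (x k - x j) (n - x k + x i) := by
  rw [hx k]
  refine distTo_coord ?_ ?_ (fun v hv => ?_) hk hkn
  · rw [← hx i]; exact Finset.mem_image_of_mem p hi
  · rw [← hx j]; exact Finset.mem_image_of_mem p hj
  · obtain ⟨l, hl, rfl⟩ := Finset.mem_image.1 hv
    exact ⟨x l, (hA l hl).1, (hA l hl).2, hx l⟩

theorem toward_image_iff (hx : ∀ k, p k = b + (x k : ZMod n)) (hi : i ∈ A) (hj : j ∈ A)
    (hA : ∀ k ∈ A, x i ≤ x k ∧ x k ≤ x j) (hk : x j < x k) (hkn : x k + 1 < n) :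
    Toward (p k) (A.image p) v ↔ (v = p k + 1 ∧ n - x k + x i ≤ x k - x j) ∨
      (v = p k - 1 ∧ x k - x j ≤ n - x k + x i) := by
  rw [hx k]
  refine toward_coord_iff ?_ ?_ (fun v hv => ?_) hk hkn
  · rw [← hx i]; exact Finset.mem_image_of_mem p hi
  · rw [← hx j]; exact Finset.mem_image_of_mem p hj
  · obtain ⟨l, hl, rfl⟩ := Finset.mem_image.1 hv
    exact ⟨x l, (hA l hl).1, (hA l hl).2, hx l⟩

end Offsets

theorem IsFrame.isBlock_interDist_iff (h : IsFrame p g) {d : ℕ} (hd : ∀ k, d ≤ g k)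
    {M : Finset (Fin 5)} (hM : ∀ k, g k = d ↔ k ∈ M) (hne : M.Nonempty) (B : Finset (ZMod n)) :
    IsBlock (multiplicity p) (interDist (multiplicity p)) B ↔
      ∃ A, Maximal (IsArc M) A ∧ B = A.image p := by
  obtain ⟨k, hk⟩ := hne
  have hk' := (hM k).2 hk
  rw [h.interDist_eq hd hk', h.isBlock_iff (hk' ▸ h.1 k)]
  simp [hM]

theorem forall_fin_five {P : Fin 5 → Prop} : (∀ k, P k) ↔ P 0 ∧ P 1 ∧ P 2 ∧ P 3 ∧ P 4 := by
  refine ⟨fun h => ⟨h 0, h 1, h 2, h 3, h 4⟩, fun ⟨h0, h1, h2, h3, h4⟩ k => ?_⟩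
  fin_cases k <;> assumption

/-- Only robots `2` and `4`, the neighbours of the block, can be closest; robot `3` lies behind them
on either side. The one with the smaller gap provides progress. -/
theorem IsFrame.sound_one (h : IsFrame p g)
    (hg : g 0 < g 1 ∧ g 0 < g 2 ∧ g 0 < g 3 ∧ g 0 < g 4) : Sound p g := by
  have hB := h.isBlock_interDist_iff (d := g 0) (M := {0})
    (by rw [forall_fin_five]; omega) (by rw [forall_fin_five]; simp; omega) (by simp)
  simp only [maximal_isArc_one, exists_eq_left] at hB
  obtain ⟨x, hx, x0, x1, x2, x3, x4⟩ := h.exists_offset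
  have hs := h.sum_eq
  have h0 := h.1 0
  have hA : ∀ k ∈ ({0, 1} : Finset (Fin 5)), x 0 ≤ x k ∧ x k ≤ x 1 := by
    rw [forall_fin_five]; simp; omega
  have hk : ∀ k ∉ ({0, 1} : Finset (Fin 5)), x 1 < x k ∧ x k + 1 < n := by
    rw [forall_fin_five]; simp; omega
  have hD : ∀ k ∉ ({0, 1} : Finset (Fin 5)), _ := fun k h =>
    distTo_image hx (i := 0) (j := 1) (by simp) (by simp) hA (hk k h).1.le
      (by have := hk k h; omega)
  have hT : ∀ k ∉ ({0, 1} : Finset (Fin 5)), ∀ v, _ := fun k h v =>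
    toward_image_iff (v := v) hx (i := 0) (j := 1) (by simp) (by simp) hA (hk k h).1 (hk k h).2
  have hBM := blockModule_iff_of_isolated_of_single h.injective hB ⟨2, by decide⟩
  have D2 := hD 2 (by decide)
  have D3 := hD 3 (by decide)
  have D4 := hD 4 (by decide)
  refine ⟨fun k v hb => ?_, fun _ => ?_⟩
  · obtain ⟨hkA, hc, hm⟩ := (hBM k v).1 hb
    have c2 := hc 2 (by decide)
    have c4 := hc 4 (by decide)
    rw [hD k hkA, D2] at c2
    rw [hD k hkA, D4] at c4
    rw [hT k hkA] at hm
    refine hm.imp (And.imp_right fun hm => ?_) (And.imp_right fun hm => ?_) <;>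
      fin_cases k <;> simp at hkA c2 c4 hm <;> left <;> simp <;> omega
  · rcases le_total (g 1) (g 4) with hle | hle
    · refine ⟨2, p 2 - 1, (hBM _ _).2 ⟨by decide, ?_,
        (hT 2 (by decide) _).2 (Or.inr ⟨rfl, by omega⟩)⟩⟩
      intro j hj
      rw [D2, hD j hj]
      revert j
      rw [forall_fin_five]; simp; omega
    · refine ⟨4, p 4 + 1, (hBM _ _).2 ⟨by decide, ?_,
        (hT 4 (by decide) _).2 (Or.inl ⟨rfl, by omega⟩)⟩⟩
      intro j hj
      rw [D4, hD j hj]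
      revert j
      rw [forall_fin_five]; simp; omega

theorem IsFrame.sound_two (h : IsFrame p g)
    (hg : g 1 = g 0 ∧ g 0 < g 2 ∧ g 0 < g 3 ∧ g 0 < g 4) : Sound p g := by
  have hB := h.isBlock_interDist_iff (d := g 0) (M := {0, 1})
    (by rw [forall_fin_five]; omega) (by rw [forall_fin_five]; simp; omega) (by simp)
  simp only [maximal_isArc_two, exists_eq_left] at hB
  obtain ⟨x, hx, x0, x1, x2, x3, x4⟩ := h.exists_offset
  have hs := h.sum_eq
  have h0 := h.1 0
  have hA : ∀ k ∈ ({0, 1, 2} : Finset (Fin 5)), x 0 ≤ x k ∧ x k ≤ x 2 := by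
    rw [forall_fin_five]; simp; omega
  have hk : ∀ k ∉ ({0, 1, 2} : Finset (Fin 5)), x 2 < x k ∧ x k + 1 < n := by
    rw [forall_fin_five]; simp; omega
  have hD : ∀ k ∉ ({0, 1, 2} : Finset (Fin 5)), _ := fun k h =>
    distTo_image hx (i := 0) (j := 2) (by simp) (by simp) hA (hk k h).1.le
      (by have := hk k h; omega)
  have hT : ∀ k ∉ ({0, 1, 2} : Finset (Fin 5)), ∀ v, _ := fun k h v =>
    toward_image_iff (v := v) hx (i := 0) (j := 2) (by simp) (by simp) hA (hk k h).1 (hk k h).2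
  have hBM := blockModule_iff_of_isolated_of_single h.injective hB ⟨3, by decide⟩
  have D3 := hD 3 (by decide)
  have D4 := hD 4 (by decide)
  refine ⟨fun k v hb => ?_, fun _ => ?_⟩
  · obtain ⟨hkA, hc, hm⟩ := (hBM k v).1 hb
    have c3 := hc 3 (by decide)
    have c4 := hc 4 (by decide)
    rw [hD k hkA, D3] at c3
    rw [hD k hkA, D4] at c4
    rw [hT k hkA] at hm
    refine hm.imp (And.imp_right fun hm => ?_) (And.imp_right fun hm => ?_) <;>
      fin_cases k <;> simp at hkA c3 c4 hm <;> right <;> left <;> simp <;> omega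
  · rcases le_total (g 2) (g 4) with hle | hle
    · refine ⟨3, p 3 - 1, (hBM _ _).2 ⟨by decide, ?_,
        (hT 3 (by decide) _).2 (Or.inr ⟨rfl, by omega⟩)⟩⟩
      intro j hj
      rw [D3, hD j hj]
      revert j
      rw [forall_fin_five]; simp; omega
    · refine ⟨4, p 4 + 1, (hBM _ _).2 ⟨by decide, ?_,
        (hT 4 (by decide) _).2 (Or.inl ⟨rfl, by omega⟩)⟩⟩
      intro j hj
      rw [D4, hD j hj]
      revert j
      rw [forall_fin_five]; simp; omega

theorem IsFrame.sound_three (h : IsFrame p g)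
    (hg : g 1 = g 0 ∧ g 2 = g 0 ∧ g 0 < g 3 ∧ g 0 < g 4) : Sound p g := by
  have hB := h.isBlock_interDist_iff (d := g 0) (M := {0, 1, 2})
    (by rw [forall_fin_five]; omega) (by rw [forall_fin_five]; simp; omega) (by simp)
  simp only [maximal_isArc_three, exists_eq_left] at hB
  obtain ⟨x, hx, x0, x1, x2, x3, x4⟩ := h.exists_offset
  have hs := h.sum_eq
  have h0 := h.1 0
  have hA : ∀ k ∈ ({0, 1, 2, 3} : Finset (Fin 5)), x 0 ≤ x k ∧ x k ≤ x 3 := by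
    rw [forall_fin_five]; simp; omega
  have hT : ∀ v, _ := fun v =>
    toward_image_iff (v := v) hx (k := 4) (i := 0) (j := 3) (by simp) (by simp) hA (by omega)
      (by omega)
  have hBM := blockModule_iff_of_isolated_of_single h.injective hB ⟨4, by decide⟩
  have h4 : ∀ j ∉ ({0, 1, 2, 3} : Finset (Fin 5)), j = 4 := by decide
  refine ⟨fun k v hb => ?_, fun _ => ?_⟩
  · obtain ⟨hkA, -, hm⟩ := (hBM k v).1 hb
    obtain rfl := h4 k hkA
    rw [hT] at hm
    refine hm.imp (And.imp_right fun hm => ?_) (And.imp_right fun hm => ?_) <;>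
      right <;> right <;> left <;> simp <;> omega
  · rcases le_total (g 3) (g 4) with hle | hle
    · exact ⟨4, p 4 - 1, (hBM _ _).2 ⟨by decide, fun j hj => by rw [h4 j hj],
        (hT _).2 (Or.inr ⟨rfl, by omega⟩)⟩⟩
    · exact ⟨4, p 4 + 1, (hBM _ _).2 ⟨by decide, fun j hj => by rw [h4 j hj],
        (hT _).2 (Or.inl ⟨rfl, by omega⟩)⟩⟩

/-- The two robots of the small block behave like the isolated robots of `IsFrame.sound_two`. This
is why the gap opposite the block of three is allowed to equal the minimum in `MayAdvance` and
`RankFrom`. -/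
theorem IsFrame.sound_two_one (h : IsFrame p g)
    (hg : g 1 = g 0 ∧ g 0 < g 2 ∧ g 3 = g 0 ∧ g 0 < g 4) : Sound p g := by
  have hB := h.isBlock_interDist_iff (d := g 0) (M := {0, 1, 3})
    (by rw [forall_fin_five]; omega) (by rw [forall_fin_five]; simp; omega) (by simp)
  simp only [maximal_isArc_two_one, or_and_right, exists_or, exists_eq_left] at hB
  obtain ⟨x, hx, x0, x1, x2, x3, x4⟩ := h.exists_offset
  have hs := h.sum_eq
  have h0 := h.1 0
  have hA : ∀ k ∈ ({0, 1, 2} : Finset (Fin 5)), x 0 ≤ x k ∧ x k ≤ x 2 := by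
    rw [forall_fin_five]; simp; omega
  have hk : ∀ k ∈ ({3, 4} : Finset (Fin 5)), x 2 < x k ∧ x k + 1 < n := by
    rw [forall_fin_five]; simp; omega
  have hD : ∀ k ∈ ({3, 4} : Finset (Fin 5)), _ := fun k h =>
    distTo_image hx (i := 0) (j := 2) (by simp) (by simp) hA (hk k h).1.le
      (by have := hk k h; omega)
  have hT : ∀ k ∈ ({3, 4} : Finset (Fin 5)), ∀ v, _ := fun k h v =>
    toward_image_iff (v := v) hx (i := 0) (j := 2) (by simp) (by simp) hA (hk k h).1 (hk k h).2
  have hBM := blockModule_iff_of_two h.injective (by decide) hB (by decide)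
  have D3 := hD 3 (by decide)
  have D4 := hD 4 (by decide)
  refine ⟨fun k v hb => ?_, fun _ => ?_⟩
  · obtain ⟨hkA, hc, hm⟩ := (hBM k v).1 hb
    have c3 := hc 3 (by decide)
    have c4 := hc 4 (by decide)
    rw [hD k hkA, D3] at c3
    rw [hD k hkA, D4] at c4
    rw [hT k hkA] at hm
    refine hm.imp (And.imp_right fun hm => ?_) (And.imp_right fun hm => ?_) <;>
      fin_cases k <;> simp at hkA c3 c4 hm <;> right <;> left <;> simp <;> omega
  · rcases le_total (g 2) (g 4) with hle | hle
    · refine ⟨3, p 3 - 1, (hBM _ _).2 ⟨by decide, ?_,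
        (hT 3 (by decide) _).2 (Or.inr ⟨rfl, by omega⟩)⟩⟩
      intro j hj
      rw [D3, hD j hj]
      revert j
      rw [forall_fin_five]; simp; omega
    · refine ⟨4, p 4 + 1, (hBM _ _).2 ⟨by decide, ?_,
        (hT 4 (by decide) _).2 (Or.inl ⟨rfl, by omega⟩)⟩⟩
      intro j hj
      rw [D4, hD j hj]
      revert j
      rw [forall_fin_five]; simp; omega

theorem IsFrame.not_occupied_sub (h : IsFrame p g) {k : Fin 5} {j : ℕ} (h₀ : 0 < j)
    (hj : j < g k) : ¬ Occupied (multiplicity p) (p (k + 1) - (j : ZMod n)) := by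
  have e : p (k + 1) - (j : ZMod n) = p k + ((g k - j : ℕ) : ZMod n) := by
    rw [h.2.2, Nat.cast_sub hj.le]; ring
  rw [e]
  exact h.not_occupied (by omega) (by omega)

/-- Robot `4` is the only robot without another robot at distance `g 0` on either side, so a
reflection must fix it and exchange its two gaps. Hence the adversary's free choice arises only
between equal distances. -/
theorem IsFrame.eq_of_symmetric (h : IsFrame p g)
    (hg : g 2 = g 0 ∧ g 0 < g 3 ∧ g 0 < g 4) (hsym : Symmetric (multiplicity p)) :
    g 3 = g 4 := by
  obtain ⟨s, hs⟩ := hsym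
  have h0 := h.1 0
  have ho : ∀ u, Occupied (multiplicity p) (s - u) ↔ Occupied (multiplicity p) u := by
    intro u; unfold Occupied; rw [hs]
  have n₁ : ¬ Occupied (multiplicity p) (p 4 + (g 0 : ZMod n)) := h.not_occupied h0 hg.2.2
  have n₂ : ¬ Occupied (multiplicity p) (p 4 - (g 0 : ZMod n)) :=
    h.not_occupied_sub (k := 3) h0 hg.2.1
  rw [← ho] at n₁ n₂
  have q1 : p 1 = p 0 + (g 0 : ZMod n) := h.2.2 0
  have q3 : p 3 = p 2 + (g 0 : ZMod n) := hg.1 ▸ h.2.2 2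
  obtain ⟨j, hj⟩ := occupied_multiplicity_iff.1 ((ho _).2 (occupied (p := p) 4))
  have e₁ : s - (p 4 + (g 0 : ZMod n)) = p j - (g 0 : ZMod n) := by rw [hj]; ring
  have e₂ : s - (p 4 - (g 0 : ZMod n)) = p j + (g 0 : ZMod n) := by rw [hj]; ring
  rw [e₁] at n₁
  rw [e₂] at n₂
  have hj4 : j = 4 := by
    fin_cases j
    · exact absurd (q1 ▸ occupied 1) n₂
    · exact absurd (show Occupied _ (p 1 - _) by rw [q1, add_sub_cancel_right]; exact occupied 0) n₁
    · exact absurd (q3 ▸ occupied 3) n₂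
    · exact absurd (show Occupied _ (p 3 - _) by rw [q3, add_sub_cancel_right]; exact occupied 2) n₁
    · rfl
  subst hj4
  have hs4 : s = p 4 + p 4 := eq_add_of_sub_eq hj.symm
  have f₁ : Occupied (multiplicity p) (p 4 - (g 4 : ZMod n)) := by
    rw [← ho, show s - (p 4 - (g 4 : ZMod n)) = p 4 + (g 4 : ZMod n) by rw [hs4]; ring]
    exact h.2.2 4 ▸ occupied _
  have f₂ : Occupied (multiplicity p) (p 4 + (g 3 : ZMod n)) := by
    rw [← ho, show s - (p 4 + (g 3 : ZMod n)) = p 4 - (g 3 : ZMod n) by rw [hs4]; ring,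
      show p 4 = p 3 + (g 3 : ZMod n) from h.2.2 3, add_sub_cancel_right]
    exact occupied 3
  by_contra hne
  rcases Nat.lt_or_gt_of_ne hne with hlt | hlt
  · exact h.not_occupied (h.1 3) hlt f₂
  · exact h.not_occupied_sub (k := 3) (h.1 4) hlt f₁

theorem IsFrame.sound_one_one (h : IsFrame p g)
    (hg : g 2 = g 0 ∧ g 0 < g 1 ∧ g 0 < g 3 ∧ g 0 < g 4) : Sound p g := by
  have hB := h.isBlock_interDist_iff (d := g 0) (M := {0, 2})
    (by rw [forall_fin_five]; omega) (by rw [forall_fin_five]; simp; omega) (by simp)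
  simp only [maximal_isArc_one_one, or_and_right, exists_or, exists_eq_left] at hB
  obtain ⟨x, hx, x0, x1, x2, x3, x4⟩ := h.exists_offset
  have hs := h.sum_eq
  have h0 := h.1 0
  have hA₁ : ∀ k ∈ ({0, 1} : Finset (Fin 5)), x 0 ≤ x k ∧ x k ≤ x 1 := by
    rw [forall_fin_five]; simp; omega
  have hA₂ : ∀ k ∈ ({2, 3} : Finset (Fin 5)), x 2 ≤ x k ∧ x k ≤ x 3 := by
    rw [forall_fin_five]; simp; omega
  have hD₁ := distTo_image hx (k := 4) (i := 0) (j := 1) (by simp) (by simp) hA₁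
    (by omega) (by omega)
  have hD₂ := distTo_image hx (k := 4) (i := 2) (j := 3) (by simp) (by simp) hA₂
    (by omega) (by omega)
  have hT₁ : ∀ v, _ := fun v => toward_image_iff (v := v) hx (k := 4) (i := 0) (j := 1)
    (by simp) (by simp) hA₁ (by omega) (by omega)
  have hT₂ : ∀ v, _ := fun v => toward_image_iff (v := v) hx (k := 4) (i := 2) (j := 3)
    (by simp) (by simp) hA₂ (by omega) (by omega)
  have h4 : ∀ j : Fin 5, j ∉ ({0, 1} : Finset (Fin 5)) ∧ j ∉ ({2, 3} : Finset (Fin 5)) → j = 4 := by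
    decide
  refine ⟨fun k v hb => ?_, fun _ => ?_⟩
  · obtain ⟨hk, hb⟩ := hb.of_isolated_of_two h.injective (by decide) hB ⟨4, by decide⟩
    obtain rfl := h4 k hk
    rw [hT₁, hT₂, hD₁, hD₂] at hb
    have key : (v = p 4 + 1 ∧ g 4 ≤ g 3) ∨ (v = p 4 - 1 ∧ g 3 ≤ g 4) := by
      rcases hb with ⟨hsym, hb⟩ | ⟨hc, hb⟩ | ⟨hc, hb⟩
      · have he := h.eq_of_symmetric ⟨hg.1, hg.2.2⟩ hsym
        rcases hb with (hb | hb) | (hb | hb)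
        exacts [Or.inl ⟨hb.1, he.ge⟩, Or.inr ⟨hb.1, he.le⟩, Or.inl ⟨hb.1, he.ge⟩,
          Or.inr ⟨hb.1, he.le⟩]
      · exact hb.imp (And.imp_right fun hb => by omega) (And.imp_right fun hb => by omega)
      · exact hb.imp (And.imp_right fun hb => by omega) (And.imp_right fun hb => by omega)
    refine key.imp (And.imp_right fun hm => ?_) (And.imp_right fun hm => ?_) <;>
      right <;> right <;> right <;> left <;> simp <;> omega
  · rcases le_total (g 4) (g 3) with hle | hle
    · refine ⟨4, p 4 + 1, blockModule_of_isolated_of_two h.injective (by decide) hB (by decide) ?_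
        ((hT₁ _).2 (Or.inl ⟨rfl, by omega⟩))⟩
      rw [hD₁, hD₂]; omega
    · refine ⟨4, p 4 - 1, blockModule_of_isolated_of_two h.injective (A₁ := {2, 3}) (A₂ := {0, 1})
        (by decide) (fun B => (hB B).trans or_comm) (by decide) ?_
        ((hT₂ _).2 (Or.inr ⟨rfl, by omega⟩))⟩
      rw [hD₁, hD₂]; omega

theorem IsFrame.sound_four (h : IsFrame p g)
    (hg : g 1 = g 0 ∧ g 2 = g 0 ∧ g 3 = g 0 ∧ g 0 < g 4) : Sound p g := by
  have hd : ∀ k, g 0 ≤ g k := by rw [forall_fin_five]; omega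
  have hB := h.isBlock_interDist_iff (d := g 0) (M := {0, 1, 2, 3})
    hd (by rw [forall_fin_five]; simp; omega) (by simp)
  simp only [maximal_isArc_four, exists_eq_left] at hB
  have hu : ({0, 1, 2, 3, 4} : Finset (Fin 5)) = Finset.univ := by decide
  rw [hu] at hB
  have hI := h.interDist_eq hd rfl
  have hpos := h.1
  have hgk : ∀ k, k ≠ 4 → g k = g 0 := by rw [forall_fin_five]; simp; omega
  have hnext : ∀ k, k ≠ 4 → p (k + 1) = p k + (g 0 : ZMod n) := fun k hk => by
    rw [h.2.2, hgk k hk]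
  refine ⟨fun k v hb => ?_, fun hns => ?_⟩
  · obtain ⟨hlarge, e, rfl | rfl, hole, rfl⟩ := hb.of_univ h.injective hB
    · have hk : k = 4 := by
        by_contra hk
        -- The hole condition includes distance `d` itself, where every robot but the border one has
        -- a neighbour on this side.
        refine hole (g 0) (hpos 0) hI.ge ?_
        rw [one_mul, ← hnext k hk]
        exact occupied _
      subst hk
      refine Or.inr ⟨rfl, ?_⟩
      right; right; right; right; left; simp; omega
    · have hk : k = 0 := by
        by_contra hk
        refine hole (g 0) (hpos 0) hI.ge ?_
        have := hnext (k - 1) ((by decide : ∀ k : Fin 5, k ≠ 0 → k - 1 ≠ 4) k hk)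
        rw [sub_add_cancel] at this
        rw [this, neg_one_mul, add_neg_cancel_right]
        exact occupied _
      subst hk
      refine Or.inl ⟨sub_neg_eq_add _ _, ?_⟩
      right; right; right; right; left; simp; omega
  · have hlarge : 1 < g 0 := by
      by_contra hle
      have h1 : g 0 = 1 := by have := hpos 0; omega
      refine hns ⟨Finset.univ.image p, ?_, by
        rw [Finset.card_image_of_injective _ h.injective]; rfl⟩
      rw [← h1, ← hI]
      exact (hB _).2 rfl
    refine ⟨4, p 4 - 1, .border _ (fun w => ?_) hB (by omega)
      (Finset.mem_image_of_mem p (Finset.mem_univ 4)) 1 (Or.inl rfl) (fun j hj hj' => ?_) rfl⟩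
    · rw [isolated_iff h.injective (𝒜 := {Finset.univ}) (by simpa using hB)]
      rintro ⟨j, -, h⟩
      exact h _ rfl (Finset.mem_univ j)
    · rw [one_mul]
      exact h.not_occupied hj (by omega)

theorem IsFrame.sound (h : IsFrame p g) {N : ℕ} (hN : GapRank g N) : Sound p g := by
  have key : ∀ {p : Fin 5 → ZMod n} {g : Fin 5 → ℕ}, IsFrame p g →
      RankFrom (g 0) (g 1) (g 2) (g 3) (g 4) N → Sound p g := by
    rintro p g h (hg | hg | hg | hg | hg)
    · exact h.sound_one ⟨hg.1, hg.2.1, hg.2.2.1, hg.2.2.2.1⟩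
    · obtain ⟨h1, h2, h3, h4, -⟩ := hg
      rcases h3.eq_or_lt with h3 | h3
      · exact h.sound_two_one ⟨h1, h2, h3.symm, h4⟩
      · exact h.sound_two ⟨h1, h2, h3, h4⟩
    · exact h.sound_three ⟨hg.1, hg.2.1, hg.2.2.1, hg.2.2.2.1⟩
    · exact h.sound_four ⟨hg.1, hg.2.1, hg.2.2.1, hg.2.2.2.1⟩
    · exact h.sound_one_one ⟨hg.1, hg.2.1, hg.2.2.1, hg.2.2.2.1⟩
  rcases hN with hN | hN | hN | hN | hN
  · exact key h hN
  · exact (key (h.shift 1) hN).of_shift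
  · exact (key (h.shift 2) hN).of_shift
  · exact (key (h.shift 3) hN).of_shift
  · exact (key (h.shift 4) hN).of_shift

/-- Sorting the representatives in `[0, n)` gives the cyclic order; the last gap wraps around
through `n`. -/
theorem exists_isFrame (hn : 0 < n) {q : Fin 5 → ZMod n} (hq : Function.Injective q) :
    ∃ (σ : Equiv.Perm (Fin 5)) (g : Fin 5 → ℕ), IsFrame (q ∘ σ) g := by
  have : NeZero n := ⟨hn.ne'⟩
  set f : Fin 5 → ℕ := fun i => (q i).val
  set σ := Tuple.sort f
  have hf : StrictMono (f ∘ σ) :=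
    (Tuple.monotone_sort f).strictMono_of_injective
      (((ZMod.val_injective n).comp hq).comp σ.injective)
  have hlt : ∀ k, f (σ k) < n := fun k => ZMod.val_lt _
  have hc : ∀ k, q (σ k) = (f (σ k) : ZMod n) := fun k => (ZMod.natCast_zmod_val _).symm
  have h01 : f (σ 0) < f (σ 1) := hf (by decide)
  have h12 : f (σ 1) < f (σ 2) := hf (by decide)
  have h23 : f (σ 2) < f (σ 3) := hf (by decide)
  have h34 : f (σ 3) < f (σ 4) := hf (by decide)
  have h4 := hlt 4
  refine ⟨σ, ![f (σ 1) - f (σ 0), f (σ 2) - f (σ 1), f (σ 3) - f (σ 2), f (σ 4) - f (σ 3),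
    n + f (σ 0) - f (σ 4)], ?_, ?_, ?_⟩
  · rw [forall_fin_five]; simp; omega
  · rw [Fin.sum_univ_five]; simp; omega
  · rw [forall_fin_five]
    simp only [Function.comp_apply, hc]
    refine ⟨?_, ?_, ?_, ?_, ?_⟩
    · change (f (σ 1) : ZMod n) = f (σ 0) + ((f (σ 1) - f (σ 0) : ℕ) : ZMod n)
      rw [Nat.cast_sub h01.le]; ring
    · change (f (σ 2) : ZMod n) = f (σ 1) + ((f (σ 2) - f (σ 1) : ℕ) : ZMod n)
      rw [Nat.cast_sub h12.le]; ring
    · change (f (σ 3) : ZMod n) = f (σ 2) + ((f (σ 3) - f (σ 2) : ℕ) : ZMod n)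
      rw [Nat.cast_sub h23.le]; ring
    · change (f (σ 4) : ZMod n) = f (σ 3) + ((f (σ 4) - f (σ 3) : ℕ) : ZMod n)
      rw [Nat.cast_sub h34.le]; ring
    · change (f (σ 0) : ZMod n) = f (σ 4) + ((n + f (σ 0) - f (σ 4) : ℕ) : ZMod n)
      rw [Nat.cast_sub (by omega), Nat.cast_add, ZMod.natCast_self]; ring

theorem IsFrame.gapRank {p : Fin 5 → ZMod n} {g : Fin 5 → ℕ} (h : IsFrame p g)
    (hn : Nat.Coprime n 5) : GapRank g (9 * n) := by
  have hs := h.sum_eq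
  have := exists_rank (x₁ := g 0) (x₂ := g 1) (x₃ := g 2) (x₄ := g 3) (x₅ := g 4) (by
    rintro ⟨h1, h2, h3, h4⟩
    have hd : 5 ∣ n := ⟨g 0, by omega⟩
    have := Nat.Coprime.eq_one_of_dvd hn.symm hd
    omega)
  rwa [hs] at this

theorem MayMove.ne {p : Fin 5 → ZMod n} {g : Fin 5 → ℕ} (h : IsFrame p g) {k : Fin 5} {v : ZMod n}
    (hv : MayMove p g k v) : v ≠ p k := by
  have hs := h.sum_eq
  have h0 := h.1 0; have h1 := h.1 1
  have : Fact (1 < n) := ⟨by omega⟩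
  rcases hv with ⟨rfl, -⟩ | ⟨rfl, -⟩ <;> simp

/-! ### Executions: the invariant and progress. -/

/-- Robot `i` may still decide, or has decided, to leave for `v`. -/
def Pending (s : State n) (i : Fin 5) (v : ZMod n) : Prop :=
  v ≠ s.pos i ∧
    ((∃ c, s.phase i = Phase.compute c ∧ Decides c (s.pos i) v) ∨ s.phase i = Phase.move v)

/-- The state `s` has admissible pending decisions, and at most `N` moves remain. -/
def Admissible (σ : Equiv.Perm (Fin 5)) (s : State n) (N : ℕ) : Prop :=
  ∃ g, IsFrame (s.pos ∘ σ) g ∧ GapRank g N ∧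
    ∀ k v, Pending s (σ k) v → MayMove (s.pos ∘ σ) g k v

theorem Admissible.not_hasTower {σ : Equiv.Perm (Fin 5)} {s : State n} {N : ℕ}
    (h : Admissible σ s N) : ¬ HasTower s.config := by
  obtain ⟨g, hF, -⟩ := h
  have := hF.not_hasTower
  rwa [multiplicity_comp_perm] at this

theorem Execution.moves_succ (E : Execution n) (t : ℕ) : E.moves (t + 1) = E.moves t +
    (Finset.univ.filter (fun i => (E.state (t + 1)).pos i ≠ (E.state t).pos i)).card :=
  Finset.sum_range_succ _ _

theorem Admissible.step {σ : Equiv.Perm (Fin 5)} {E : Execution n} {t N : ℕ}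
    (h : Admissible σ (E.state t) N) (hns : ¬ IsSingleOneBlock (E.state t).config) :
    ∃ N', Admissible σ (E.state (t + 1)) N' ∧ N' + E.moves (t + 1) = N + E.moves t := by
  have hnt := h.not_hasTower
  obtain ⟨g, hF, hN, hP⟩ := h
  have hsound := (hF.sound hN).1
  rw [multiplicity_comp_perm] at hsound
  set s := E.state t
  set s' := E.state (t + 1)
  -- A robot looking now sees the configuration before the simultaneous moves, so its future
  -- decisions must be carried through those moves together with the pending ones.
  let O : Fin 5 → ZMod n → Prop := fun k v =>
    Pending s (σ k) v ∨ (s.phase (σ k) = Phase.look ∧ BlockModule s.config (s.pos (σ k)) v)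
  have hO : ∀ k v, O k v → MayMove (s.pos ∘ σ) g k v := by
    rintro k v (hv | ⟨-, hv⟩)
    exacts [hP k v hv, hsound k v hv]
  let S : Finset (Fin 5) := Finset.univ.filter fun k => s'.pos (σ k) ≠ s.pos (σ k)
  have hS : ∀ k, k ∈ S ↔ s'.pos (σ k) ≠ s.pos (σ k) := fun k => by simp [S]
  have hmove : ∀ k ∈ S, s.phase (σ k) = Phase.move (s'.pos (σ k)) ∧
      s'.phase (σ k) = Phase.look := by
    intro k hk
    rw [hS] at hk
    by_cases ha : σ k ∈ E.active t
    · rcases E.step_active t _ ha with ⟨-, hp, -⟩ | ⟨-, -, -, -, hp, -⟩ | ⟨v, hv, hp, hq⟩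
      · exact absurd hp hk
      · exact absurd hp hk
      · exact ⟨hp ▸ hv, hq⟩
    · exact absurd (E.step_inactive t _ ha).1 hk
  obtain ⟨g', hF', hle, hN', hP'⟩ := MayMove.simultaneous hF hN O hO (s'.pos ∘ σ) S
    fun k hk => Or.inl ⟨(hS k).1 hk, Or.inr (hmove k hk).1⟩
  have hpos : (fun k => if k ∈ S then (s'.pos ∘ σ) k else (s.pos ∘ σ) k) = s'.pos ∘ σ := by
    funext k
    by_cases hk : k ∈ S
    · simp [hk]
    · rw [if_neg hk]
      rw [hS, not_not] at hk
      exact hk.symm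
  rw [hpos] at hF' hP'
  refine ⟨N - S.card, ⟨g', hF', hN', fun k v hv => ?_⟩, ?_⟩
  -- A robot that has just moved is about to look, so it has nothing pending.
  · have hkS : k ∉ S := by
      intro hk
      have hl := (hmove k hk).2
      rcases hv.2 with ⟨c, hc, -⟩ | hc <;> rw [hl] at hc <;> cases hc
    have heq : s'.pos (σ k) = s.pos (σ k) := by rwa [hS, not_not] at hkS
    refine hP' k hkS v ?_
    obtain ⟨hne, hv⟩ := hv
    rw [heq] at hne hv
    by_cases ha : σ k ∈ E.active t
    · rcases E.step_active t _ ha with ⟨hl, -, hq⟩ | ⟨c, w, hc, hw, -, hq⟩ | ⟨w, -, -, hq⟩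
      · rcases hv with ⟨c, hc, hd⟩ | hc
        · obtain rfl : s.config = c := by
            have := hq.symm.trans hc; injection this
          refine Or.inr ⟨hl, (hd.2 ⟨hnt, hns⟩).resolve_right fun h => hne h.1⟩
        · exact absurd (hq.symm.trans hc) (by simp)
      · rcases hv with ⟨c', hc', -⟩ | hc'
        · exact absurd (hq.symm.trans hc') (by simp)
        · obtain rfl : w = v := by
            have := hq.symm.trans hc'; injection this
          exact Or.inl ⟨hne, Or.inl ⟨c, hc, hw⟩⟩
      · rcases hv with ⟨c', hc', -⟩ | hc' <;> exact absurd (hq.symm.trans ‹_›) (by simp)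
    · rw [show s'.phase (σ k) = s.phase (σ k) from (E.step_inactive t _ ha).2] at hv
      exact Or.inl ⟨hne, hv⟩
  · have hcard : (Finset.univ.filter (fun i => s'.pos i ≠ s.pos i)).card = S.card := by
      refine (Finset.card_bij (fun k _ => σ k) (fun k hk => by simpa [S] using hk)
        (fun _ _ _ _ h => σ.injective h) fun i hi => ⟨σ.symm i, ?_, by simp⟩).symm
      simpa [S] using hi
    rw [E.moves_succ, hcard]
    omega

theorem Execution.exists_next (E : Execution n) (i : Fin 5) (t : ℕ) :
    ∃ t' ≥ t, i ∈ E.active t' ∧ (E.state t').phase i = (E.state t).phase i := by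
  classical
  have hex : ∃ m, i ∈ E.active (t + m) := by
    obtain ⟨t', ht', h⟩ := E.fair i t
    exact ⟨t' - t, by rwa [Nat.add_sub_cancel' ht']⟩
  refine ⟨t + Nat.find hex, by omega, Nat.find_spec hex, ?_⟩
  have : ∀ m ≤ Nat.find hex, (E.state (t + m)).phase i = (E.state t).phase i := by
    intro m
    induction m with
    | zero => intro; rfl
    | succ m ih =>
      intro hm
      rw [← ih (by omega)]
      exact (E.step_inactive (t + m) i (Nat.find_min hex (by omega))).2
  exact this _ le_rfl

/-- A robot that the Block Module wants to move does not wait forever. -/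
theorem Execution.exists_move (E : Execution n) (T : ℕ) {i : Fin 5} {v : ZMod n}
    (hT : ¬ HasTower (E.state T).config ∧ ¬ IsSingleOneBlock (E.state T).config)
    (hv : BlockModule (E.state T).config ((E.state T).pos i) v)
    (hne : ∀ w, BlockModule (E.state T).config ((E.state T).pos i) w → w ≠ (E.state T).pos i) :
    ∃ t ≥ T, (E.state t).pos ≠ (E.state T).pos := by
  -- If positions were frozen, robot `i` would finish its cycle, look at the frozen configuration
  -- and carry out a genuine move.
  by_contra! hc
  have hcfg : ∀ t ≥ T, (E.state t).config = (E.state T).config := fun t ht => by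
    unfold State.config; rw [hc t ht]
  have hmove : ∀ t ≥ T, ∀ w, (E.state t).phase i = Phase.move w →
      w = (E.state T).pos i ∧ ∃ t' ≥ T, (E.state t').phase i = Phase.look := by
    intro t ht w hw
    obtain ⟨t', ht', ha, hp⟩ := E.exists_next i t
    rw [hw] at hp
    rcases E.step_active t' i ha with ⟨hl, -, -⟩ | ⟨c, w', hl, -, -, -⟩ | ⟨w', hl, hp', hq⟩
    · exact absurd (hp.symm.trans hl) (by simp)
    · exact absurd (hp.symm.trans hl) (by simp)
    · obtain rfl : w = w' := by have := hp.symm.trans hl; injection this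
      rw [hc (t' + 1) (by omega)] at hp'
      exact ⟨hp'.symm, t' + 1, by omega, hq⟩
  have hcompute : ∀ t ≥ T, ∀ c, (E.state t).phase i = Phase.compute c →
      ∃ t' ≥ T, ∃ w, (E.state t').phase i = Phase.move w ∧ Decides c ((E.state T).pos i) w := by
    intro t ht c hw
    obtain ⟨t', ht', ha, hp⟩ := E.exists_next i t
    rw [hw] at hp
    rcases E.step_active t' i ha with ⟨hl, -, -⟩ | ⟨c', w', hl, hd, -, hq⟩ | ⟨w', hl, -, -⟩
    · exact absurd (hp.symm.trans hl) (by simp)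
    · obtain rfl : c = c' := by have := hp.symm.trans hl; injection this
      rw [hc t' (by omega)] at hd
      exact ⟨t' + 1, by omega, w', hq, hd⟩
    · exact absurd (hp.symm.trans hl) (by simp)
  have hlook : ∃ t ≥ T, (E.state t).phase i = Phase.look := by
    rcases hph : (E.state T).phase i with _ | c | w
    · exact ⟨T, le_rfl, hph⟩
    · obtain ⟨t', ht', w, hw, -⟩ := hcompute T le_rfl c hph
      exact (hmove t' ht' w hw).2
    · exact (hmove T le_rfl w hph).2
  obtain ⟨t, ht, hl⟩ := hlook
  obtain ⟨t', ht', ha, hp⟩ := E.exists_next i t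
  rw [hl] at hp
  rcases E.step_active t' i ha with ⟨-, -, hq⟩ | ⟨c', w', hl', -, -, -⟩ | ⟨w', hl', -, -⟩
  · rw [hcfg t' (by omega)] at hq
    obtain ⟨t'', ht'', w, hw, hd⟩ := hcompute (t' + 1) (by omega) _ hq
    rcases hd.2 hT with hb | ⟨-, hb⟩
    · exact hne w hb (hmove t'' ht'' w hw).1
    · exact hb v hv
  · exact absurd (hp.symm.trans hl') (by simp)
  · exact absurd (hp.symm.trans hl') (by simp)

theorem Execution.moves_mono (E : Execution n) : Monotone E.moves :=
  monotone_nat_of_le_succ fun t => by rw [E.moves_succ]; exact Nat.le_add_right _ _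

theorem Execution.pos_eq_of_moves_eq (E : Execution n) {T : ℕ}
    (h : ∀ t ≥ T, E.moves t = E.moves T) : ∀ t ≥ T, (E.state t).pos = (E.state T).pos := by
  refine Nat.le_induction rfl fun t ht ih => ?_
  rw [← ih]
  have h₁ := h (t + 1) (by omega)
  rw [E.moves_succ, h t ht] at h₁
  have h₂ := Finset.card_eq_zero.1 (Nat.add_eq_left.1 h₁)
  funext i
  by_contra hne
  have : i ∈ Finset.univ.filter (fun i => (E.state (t + 1)).pos i ≠ (E.state t).pos i) := by
    simpa using hne
  rw [h₂] at this
  simp at this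

end RingRobots

/-! ### Convergence to a single `1`.block. -/

theorem mainTheorem2 :
    ∃ C : ℕ, ∀ n : ℕ, Nat.Coprime n 5 → ∀ E : RingRobots.Execution n,
      ¬ RingRobots.HasTower (E.state 0).config →
      ∃ t : ℕ, RingRobots.IsSingleOneBlock (E.state t).config ∧
        (∀ s ≤ t, ¬ RingRobots.HasTower (E.state s).config) ∧
        E.moves t ≤ C * n := by
  classical
  refine ⟨9, fun n hn E h₀ => ?_⟩
  have hpos : 0 < n := Nat.pos_of_ne_zero (by rintro rfl; simp at hn)
  rw [RingRobots.State.config, RingRobots.hasTower_multiplicity_iff, not_not] at h₀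
  obtain ⟨σ, g, hF⟩ := RingRobots.exists_isFrame hpos h₀
  have hadm : ∀ t, (∀ s < t, ¬ RingRobots.IsSingleOneBlock (E.state s).config) →
      ∃ N, RingRobots.Admissible σ (E.state t) N ∧ N + E.moves t = 9 * n := by
    intro t
    induction t with
    | zero =>
      refine fun _ => ⟨9 * n, ⟨g, hF, hF.gapRank hn, ?_⟩, by simp [RingRobots.Execution.moves]⟩
      rintro k v ⟨-, ⟨c, hc, -⟩ | hc⟩ <;> exact absurd ((E.init _).symm.trans hc) (by simp)
    | succ t ih =>
      intro hs
      obtain ⟨N, hN, hm⟩ := ih fun s hst => hs s (by omega)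
      obtain ⟨N', hN', hm'⟩ := hN.step (hs t (by omega))
      exact ⟨N', hN', hm'.trans hm⟩
  have hex : ∃ t, RingRobots.IsSingleOneBlock (E.state t).config := by
    by_contra! hno
    -- The bounded counter attains its supremum at some `T`, after which nobody moves; this
    -- contradicts progress at `T`.
    have hbd : ∃ M, ∃ T, E.moves T = M ∧ ∀ t, E.moves t ≤ M := by
      have hne : (Set.range E.moves).Nonempty := Set.range_nonempty _
      have hb : BddAbove (Set.range E.moves) := by
        refine ⟨9 * n, ?_⟩
        rintro _ ⟨t, rfl⟩
        obtain ⟨N, -, hm⟩ := hadm t fun s _ => hno s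
        omega
      obtain ⟨T, hT⟩ := Nat.sSup_mem hne hb
      exact ⟨_, T, hT, fun t => le_csSup hb ⟨t, rfl⟩⟩
    obtain ⟨_, T, rfl, hT⟩ := hbd
    have hconst := E.pos_eq_of_moves_eq fun t ht => le_antisymm (hT t) (E.moves_mono ht)
    obtain ⟨N, hN, -⟩ := hadm T fun s _ => hno s
    have hnt := hN.not_hasTower
    obtain ⟨g', hF', hN', -⟩ := hN
    obtain ⟨hsound, hlive⟩ := hF'.sound hN'
    rw [RingRobots.multiplicity_comp_perm] at hsound hlive
    obtain ⟨k, v, hv⟩ := hlive (hno T)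
    obtain ⟨t, ht, hne⟩ := E.exists_move T ⟨hnt, hno T⟩ hv
      fun w hw => (hsound k w hw).ne hF'
    exact hne (hconst t ht)
  -- The first such instant is needed: the invariant is guaranteed only as long as no earlier
  -- configuration was a single `1`.block.
  refine ⟨Nat.find hex, Nat.find_spec hex, fun s hs => ?_, ?_⟩
  · obtain ⟨N, hN, -⟩ := hadm s fun s' hs' => Nat.find_min hex (by omega)
    exact hN.not_hasTower
  · obtain ⟨N, -, hm⟩ := hadm (Nat.find hex) fun s' hs' => Nat.find_min hex hs'
    omega
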